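/- Let $H$ be a real Hilbert space, let $A:D(A)\subset H\to H$ generate a $C_0$-semigroup on $H$, let $f:H\to H$ be globally Lipschitz, and let $b\in D(A)$, $c\in D(A^*)$ with $\gamma:=\langle b,c\rangle>0$. Consider the system $$\dot x=Ax+f(x)+b(u+d),\qquad y=\langle x,c\rangle,\qquad x(0)=x_0\in H .$$ Put $\mathcal I=\{b\}^\perp$, let $P^\perp$ be the orthogonal projection of $H$ onto $\mathcal I$, and put $P_{\mathcal I}x=x-\frac{\langle x,b\rangle}{\langle c,b\rangle}c$. Define $P_0y=y\frac{\langle A^*c,b\rangle}{\langle c,b\rangle}$, $S\eta=\langle\eta,P_{\mathcal I}A^*c\rangle$, $Ry=y\frac{P^\perp Ab}{\langle c,b\rangle}$, $Q\eta=P^\perp A\eta-\frac{\langle c,\eta\rangle}{\langle c,b\rangle}P^\perp Ab$ with $D(Q)=D(A)\cap\mathcal I$, and $\tilde f(y,\eta)=f\big(y\frac{b}{\langle c,b\rangle}+\eta-\langle c,\eta\rangle\frac{b}{\langle c,b\rangle}\big)$ for $y\in\mathbb R$, $\eta\in\mathcal I$. Consider the subsystem $$\dot\eta=Ry+Q\eta+P^\perp\tilde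 f(y,\eta),\qquad \eta(0)=\eta_0\in\mathcal I,\tag{1}$$ with input $y\in C(\mathbb R^+,\mathbb R)$ and output $\eta$. Mild solutions are understood in the sense of the variation-of-constants formula. Assume that (1) is BISBO stable: for all $k,\hat k>0$ there is $\tilde k>0$ such that for all $y\in C(\mathbb R^+,\mathbb R)$ and $\eta_0\in\mathcal I$ with $\sup_t|y(t)|\le k$ and $\|\eta_0\|\le\hat k$, the mild solution of (1) satisfies $\sup_t\|\eta(t)\|\le\tilde k$. Then: 1. For all $\eta_0\in\mathcal I$ and $y\in C(\mathbb R^+,\mathbb R)$, (1) has a unique mild solution $\eta$ on $[0,\infty)$, so that for each $\eta_0$ the operator $$T(y)(t)=P_0y(t)+S\eta(t)+\langle\tilde f(y(t),\eta(t)),c\rangle$$ is well defined on $C(\mathbb R^+,\mathbb R)$. 2. If $v\in L^\infty_{\rm loc}(\mathbb R^+,\mathbb R)$ and $x$ is a mild solution of $\dot x=Ax+f(x)+bv$, $x(0)=x_0$, on $[0,\infty)$, then, with $y=\langle x,c\rangle$, the function $P^\perp x$ is the mild solution of (1) with $\eta_0=P^\perp x_0$, and $y(t)=\langle x_0,c\rangle+\int_0^t\big(T(y)(s)+\gamma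 v(s)\big)\,ds$ for all $t\ge0$. 3. For every $\eta_0\in\mathcal I$, $T$ maps $C(\mathbb R^+,\mathbb R)$ into $L^\infty_{\rm loc}(\mathbb R^+,\mathbb R)$ and is (a) BIBO: for every $k_1>0$ there is $k_2>0$ such that $\sup_t|y(t)|\le k_1$ implies $\sup_t|T(y)(t)|\le k_2$; (b) causal: $y|_{[0,t)}=\hat y|_{[0,t)}$ implies $T(y)|_{[0,t)}=T(\hat y)|_{[0,t)}$; (c) locally Lipschitz: for all $t\ge0$ and $y\in C([0,t],\mathbb R)$ there are $\tau,\delta,\rho>0$ such that for all $y_1,y_2\in C(\mathbb R^+,\mathbb R)$ with $y_i|_{[0,t]}=y$ and $|y_i(s)-y(t)|<\delta$ for $s\in[t,t+\tau]$, $i=1,2$, one has $\sup_{[t,t+\tau]}|T(y_1)-T(y_2)|\le\rho\sup_{[t,t+\tau]}|y_1-y_2|$. 4. Funnel control is feasible: let $d\in L^\infty(\mathbb R^+,\mathbb R)$, $y_{\rm ref}\in W^{1,\infty}(\mathbb R^+,\mathbb R)$, let $\phi\in W^{1,\infty}(\mathbb R^+,\mathbb R)$ (continuous representative) with $\phi>0$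 and $\liminf_{t\to\infty}\phi(t)>0$, and let $x_0\in H$ with $\phi(0)|\langle x_0,c\rangle-y_{\rm ref}(0)|<1$. Put $e=y-y_{\rm ref}$, $k=\frac1{1-\phi^2e^2}$ and $u=-ke=\frac{-e}{1-\phi^2e^2}$. Then the closed loop has a mild solution $x$ on $[0,\infty)$ that stays in the funnel, $\phi(t)|e(t)|<1$ for all $t\ge0$; every mild solution on an interval $[0,\omega)$, $\omega\in(0,\infty]$, that stays in the funnel is a restriction of it; $u$, $k$ and $y$ are bounded; and there is $\epsilon>0$ with $|e(t)|\le\frac1{\phi(t)}-\epsilon$ for all $t\ge0$. -/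

import Mathlib

open MeasureTheory Filter Topology Set
open scoped NNReal ENNReal RealInnerProductSpace LinearPMap

noncomputable section

namespace Funnel

/-! ### Semigroups and mild solutions -/

/-- A strongly continuous semigroup of bounded linear operators on a real normed space. -/
structure C0Semigroup (E : Type*) [NormedAddCommGroup E] [NormedSpace ℝ E] where
  /-- the family of operators -/
  op : ℝ≥0 → E →L[ℝ] E
  op_zero : op 0 = ContinuousLinearMap.id ℝ E
  op_add : ∀ s t, op (s + t) = (op s).comp (op t)
  tendsto_op : ∀ x, Tendsto (fun t => op t x) (𝓝[>] 0) (𝓝 x)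

/-- `A` is the infinitesimal generator of `S`: its graph consists of the pairs `(x, z)` such that
the difference quotients of `t ↦ S t x` at `0` converge to `z`. -/
def C0Semigroup.IsGenerator {E : Type*} [NormedAddCommGroup E] [NormedSpace ℝ E]
    (S : C0Semigroup E) (A : E →ₗ.[ℝ] E) : Prop :=
  ∀ x z : E, (x, z) ∈ A.graph ↔
    Tendsto (fun t : ℝ≥0 => (t : ℝ)⁻¹ • (S.op t x - x)) (𝓝[>] 0) (𝓝 z)

/-- `A` generates a strongly continuous semigroup. -/
def GeneratesC0Semigroup {E : Type*} [NormedAddCommGroup E] [NormedSpace ℝ E]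
    (A : E →ₗ.[ℝ] E) : Prop :=
  ∃ S : C0Semigroup E, S.IsGenerator A

/-- `z` is a mild solution of `z' = A z + g`, `z 0 = z₀`, on `[0, ω)`: for the semigroup `S`
generated by `A`, `z` is continuous and `z t = S t z₀ + ∫₀ᵗ S (t - s) (g s) ds`. -/
def IsMildSolution {E : Type*} [NormedAddCommGroup E] [NormedSpace ℝ E]
    (A : E →ₗ.[ℝ] E) (z₀ : E) (g : ℝ≥0 → E) (ω : ℝ≥0∞) (z : ℝ≥0 → E) : Prop :=
  ∃ S : C0Semigroup E, S.IsGenerator A ∧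
    ContinuousOn z {t : ℝ≥0 | (t : ℝ≥0∞) < ω} ∧
    ∀ t : ℝ≥0, (t : ℝ≥0∞) < ω →
      z t = S.op t z₀ + ∫ s in (0 : ℝ)..t, S.op (t - s.toNNReal) (g s.toNNReal)

/-! ### Function classes on `[0, ∞)` -/

/-- `g ∈ L^∞(ℝ⁺, ℝ)`. -/
def MemLinfty (g : ℝ≥0 → ℝ) : Prop :=
  MemLp (fun s : ℝ => g s.toNNReal) ∞ (volume.restrict (Ici 0))

/-- `g ∈ L^∞_loc(ℝ⁺, ℝ)`. -/
def MemLinftyLoc (g : ℝ≥0 → ℝ) : Prop :=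
  ∀ t : ℝ≥0, MemLp (fun s : ℝ => g s.toNNReal) ∞ (volume.restrict (Icc 0 (t : ℝ)))

/-- `g ∈ W^{1,∞}(ℝ⁺, ℝ)`, for the continuous representative: `g` is bounded and is the
indefinite integral of a function in `L^∞`. -/
def MemW1infty (g : ℝ≥0 → ℝ) : Prop :=
  MemLinfty g ∧ ∃ g' : ℝ≥0 → ℝ, MemLinfty g' ∧
    ∀ t : ℝ≥0, g t = g 0 + ∫ s in (0 : ℝ)..t, g' s.toNNReal

/-- The set `Φ` of admissible funnel functions: `φ` is continuous, `φ, φ' ∈ L^∞`, `φ > 0` and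
`liminf φ > 0` at infinity. -/
structure IsFunnelFunction (φ : ℝ≥0 → ℝ) : Prop where
  memW1infty : MemW1infty φ
  pos : ∀ t, 0 < φ t
  liminf_pos : 0 < liminf φ atTop

/-! ### The class of operators -/

/-- The class of operators `T : C(ℝ⁺, ℝ) → L^∞_loc(ℝ⁺, ℝ)` that are BIBO stable, causal and
locally Lipschitz. -/
structure IsAdmissibleOperator (T : C(ℝ≥0, ℝ) → ℝ≥0 → ℝ) : Prop where
  memLinftyLoc : ∀ y, MemLinftyLoc (T y)
  bibo : ∀ k₁ : ℝ, 0 < k₁ → ∃ k₂ : ℝ, 0 < k₂ ∧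
    ∀ y : C(ℝ≥0, ℝ), (∀ t, |y t| ≤ k₁) → ∀ t, |T y t| ≤ k₂
  causal : ∀ (t : ℝ≥0) (y y' : C(ℝ≥0, ℝ)), (∀ s < t, y s = y' s) → ∀ s < t, T y s = T y' s
  locallyLipschitz : ∀ (t : ℝ≥0) (y : C(Iic t, ℝ)),
    ∃ (τ : ℝ≥0) (δ ρ : ℝ), 0 < τ ∧ 0 < δ ∧ 0 < ρ ∧
      ∀ y₁ y₂ : C(ℝ≥0, ℝ),
        (∀ s : Iic t, y₁ s = y s) → (∀ s : Iic t, y₂ s = y s) →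
        (∀ s ∈ Icc t (t + τ), |y₁ s - y ⟨t, self_mem_Iic⟩| < δ) →
        (∀ s ∈ Icc t (t + τ), |y₂ s - y ⟨t, self_mem_Iic⟩| < δ) →
        ∀ s ∈ Icc t (t + τ),
          |T y₁ s - T y₂ s| ≤ ρ * ⨆ r : Icc t (t + τ), |y₁ r - y₂ r|

/-! ### Byrnes–Isidori form

The system is `x' = A x + f x + b v`, `y = ⟪x, c⟫`, with `b ∈ D(A)` and `c ∈ D(A*)`. -/

variable {H : Type*} [NormedAddCommGroup H] [InnerProductSpace ℝ H] [CompleteSpace H]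

/-- The space `ℐ = {b}^⊥` of the internal state. -/
abbrev InternalSpace (b : H) : Submodule ℝ H := (ℝ ∙ b)ᗮ

/-- The orthogonal projection `P^⊥` of `H` onto `ℐ`. -/
def projI (b : H) : H →L[ℝ] InternalSpace b := (InternalSpace b).orthogonalProjectionOnto

/-- The oblique projection `P_ℐ x = x - (⟪x, b⟫ / ⟪c, b⟫) c` along `c`. -/
def obliqueProj (b c x : H) : H := x - (⟪x, b⟫ / ⟪c, b⟫) • c

/-- The inverse change of variables `x = U^* (y, η)`. -/
def stateOf (b c : H) (y : ℝ) (η : InternalSpace b) : H :=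
  (y / ⟪c, b⟫) • b + (η : H) - (⟪c, (η : H)⟫ / ⟪c, b⟫) • b

/-- `f̃ (y, η) = f (U^* (y, η))`. -/
def fTilde (f : H → H) (b c : H) (y : ℝ) (η : InternalSpace b) : H := f (stateOf b c y η)

/-- `P₀ y = y ⟪A* c, b⟫ / ⟪c, b⟫`. -/
def opP0 (A : H →ₗ.[ℝ] H) (b : A.domain) (c : A†.domain) (y : ℝ) : ℝ :=
  y * (⟪A† c, (b : H)⟫ / ⟪(c : H), (b : H)⟫)

/-- `S η = ⟪η, P_ℐ A* c⟫`. -/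
def opS (A : H →ₗ.[ℝ] H) (b : A.domain) (c : A†.domain) (η : InternalSpace (b : H)) : ℝ :=
  ⟪(η : H), obliqueProj (b : H) (c : H) (A† c)⟫

/-- `R y = (y / ⟪c, b⟫) P^⊥ A b`. -/
def opR (A : H →ₗ.[ℝ] H) (b : A.domain) (c : A†.domain) (y : ℝ) : InternalSpace (b : H) :=
  (y / ⟪(c : H), (b : H)⟫) • projI (b : H) (A b)

/-- `Q η = P^⊥ A η - (⟪c, η⟫ / ⟪c, b⟫) P^⊥ A b`, with domain `D(A) ∩ ℐ`. -/
def opQ (A : H →ₗ.[ℝ] H) (b : A.domain) (c : A†.domain) :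
    InternalSpace (b : H) →ₗ.[ℝ] InternalSpace (b : H) where
  domain := A.domain.comap (InternalSpace (b : H)).subtype
  toFun :=
    { toFun := fun η => projI (b : H) (A ⟨((η : InternalSpace (b : H)) : H), η.2⟩) -
        (⟪(c : H), ((η : InternalSpace (b : H)) : H)⟫ / ⟪(c : H), (b : H)⟫) • projI (b : H) (A b)
      map_add' := by
        intro η ζ
        have h : A ⟨((η + ζ : A.domain.comap (InternalSpace (b : H)).subtype) :
            InternalSpace (b : H)), (η + ζ).2⟩ =
            A ⟨((η : InternalSpace (b : H)) : H), η.2⟩ +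
              A ⟨((ζ : InternalSpace (b : H)) : H), ζ.2⟩ := by
          rw [← A.map_add]; rfl
        rw [h]
        simp only [Submodule.coe_add, inner_add_right, add_div, add_smul, map_add]
        abel
      map_smul' := by
        intro r η
        have h : A ⟨((r • η : A.domain.comap (InternalSpace (b : H)).subtype) :
            InternalSpace (b : H)), (r • η).2⟩ =
            r • A ⟨((η : InternalSpace (b : H)) : H), η.2⟩ := by
          rw [← A.map_smul]; rfl
        rw [h]
        simp only [Submodule.coe_smul, inner_smul_right, mul_div_assoc, mul_smul, map_smul,
          RingHom.id_apply, smul_sub] }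

/-- `η` is the mild solution on `[0, ∞)` of the internal dynamics
`η' = R y + Q η + P^⊥ f̃ (y, η)`, `η 0 = η₀`, driven by `y`. -/
def IsInternalSolution (A : H →ₗ.[ℝ] H) (f : H → H) (b : A.domain) (c : A†.domain)
    (η₀ : InternalSpace (b : H)) (y : C(ℝ≥0, ℝ)) (η : C(ℝ≥0, InternalSpace (b : H))) : Prop :=
  IsMildSolution (opQ A b c) η₀
    (fun s => opR A b c (y s) + projI (b : H) (fTilde f (b : H) (c : H) (y s) (η s))) ∞ η

/-- The internal dynamics, with input `y` and output `η`, is BISBO stable. -/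
def IsBISBOStable (A : H →ₗ.[ℝ] H) (f : H → H) (b : A.domain) (c : A†.domain) : Prop :=
  ∀ k k' : ℝ, 0 < k → 0 < k' → ∃ K : ℝ, 0 < K ∧
    ∀ (y : C(ℝ≥0, ℝ)) (η₀ : InternalSpace (b : H)) (η : C(ℝ≥0, InternalSpace (b : H))),
      IsInternalSolution A f b c η₀ y η → (∀ t, |y t| ≤ k) → ‖η₀‖ ≤ k' → ∀ t, ‖η t‖ ≤ K

/-- The mild solution of the internal dynamics driven by `y` with initial value `η₀` (a junk value
if there is none). -/
def internalState (A : H →ₗ.[ℝ] H) (f : H → H) (b : A.domain) (c : A†.domain)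
    (η₀ : InternalSpace (b : H)) (y : C(ℝ≥0, ℝ)) : C(ℝ≥0, InternalSpace (b : H)) :=
  Classical.epsilon (IsInternalSolution A f b c η₀ y)

/-- The operator `T (y) = P₀ y + S η + ⟪f̃ (y, η), c⟫`, where `η` is the mild solution of the
internal dynamics driven by `y` with `η 0 = η₀`. -/
def outputOperator (A : H →ₗ.[ℝ] H) (f : H → H) (b : A.domain) (c : A†.domain)
    (η₀ : InternalSpace (b : H)) (y : C(ℝ≥0, ℝ)) (t : ℝ≥0) : ℝ :=
  opP0 A b c (y t) + opS A b c (internalState A f b c η₀ y t) +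
    ⟪fTilde f (b : H) (c : H) (y t) (internalState A f b c η₀ y t), (c : H)⟫

/-! ### The closed loop with the funnel controller -/

/-- The gain `k = 1 / (1 - φ² e²)`. -/
def funnelGain (φ : ℝ≥0 → ℝ) (e : ℝ≥0 → ℝ) (t : ℝ≥0) : ℝ := 1 / (1 - φ t ^ 2 * e t ^ 2)

/-- The funnel controller `u = -e / (1 - φ² e²)`. -/
def funnelControl (φ : ℝ≥0 → ℝ) (e : ℝ≥0 → ℝ) (t : ℝ≥0) : ℝ := -e t / (1 - φ t ^ 2 * e t ^ 2)

/-- The tracking error `e = ⟪x, c⟫ - y_ref`. -/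
def trackingError (c : H) (yref : ℝ≥0 → ℝ) (x : ℝ≥0 → H) (t : ℝ≥0) : ℝ := ⟪x t, c⟫ - yref t

/-- `x` is a mild solution on `[0, ω)` of the closed loop `x' = A x + f x + b (u + d)`, `x 0 = x₀`,
with `u` given by the funnel controller; since the latter is defined inside the funnel only,
`(t, e t)` has to stay in the funnel. -/
def IsClosedLoopSolution (A : H →ₗ.[ℝ] H) (f : H → H) (b c : H) (d yref φ : ℝ≥0 → ℝ)
    (x₀ : H) (ω : ℝ≥0∞) (x : ℝ≥0 → H) : Prop :=
  (∀ t : ℝ≥0, (t : ℝ≥0∞) < ω → φ t * |trackingError c yref x t| < 1) ∧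
    IsMildSolution A x₀
      (fun s => f (x s) + (funnelControl φ (trackingError c yref x) s + d s) • b) ω x

end Funnel

end

open MeasureTheory Filter Topology Set
open scoped NNReal ENNReal RealInnerProductSpace LinearPMap

noncomputable section

namespace Funnel

/-! ### Strongly continuous semigroups -/

section Semigroup

/-! Since `⟪c, b⟫ ≠ 0`, the map `x ↦ (⟪x, c⟫, P^⊥ x)` is an isomorphism with inverse `stateOf`, and
the whole proof moves between the two descriptions of the state. Mild solutions need not be
differentiable, so they are transferred in integrated form: `x` is mild with forcing `g` exactly
when `(∫₀ᵗ x, x t - x₀ - ∫₀ᵗ g)` lies in the graph of `A` for all `t ≥ 0`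
(`IsGenerator.integral_mem_graph`, `IsGenerator.eq_mild`). Changes of variables then become linear
algebra on graphs: projecting gives the internal dynamics, and pairing with `c ∈ D(A*)` gives the
output equation (`byrnesIsidori_form`).

`Q` generates a semigroup because the bounded perturbation `A - γ⁻¹ ⟪A* c, ·⟫ b` generates one that
conserves `⟪c, ·⟫`. It therefore leaves `ker ⟪c, ·⟫` invariant, and `P^⊥` identifies this kernel
with `{b}^⊥` and the restricted generator with `Q` (`generates_opQ`). Global existence, uniqueness
and continuous dependence for the internal dynamics follow from a weighted contraction and
Grönwall's inequality. With BISBO stability they give the properties of `T`.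

The funnel controller is singular at the boundary, so it is replaced by a globally Lipschitz
saturation at the level `φ |e| = r < 1`, whose closed loop has a global solution. As long as the
solution is in the funnel, `y` is bounded independently of `r`, and by causality and BIBO so is `T
y`. Above level `r` the saturated control pushes `e` towards zero with strength at least `r / (1 -
r²)` divided by `sup φ`, which for `r` near `1` dominates all other terms. Hence `φ |e|` never
exceeds `r` (`exists_invariant_level`), and there the saturated and the true controller coincide.
Uniqueness holds because on a compact time interval a solution in the funnel keeps a positive
distance from the boundary and so solves a saturated equation. -/

theorem intervalIntegrable_of_locallyIntegrable {E : Type*} [NormedAddCommGroup E]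
    {g : ℝ → E}
    (hg : LocallyIntegrable g) (a b : ℝ) :
    IntervalIntegrable g volume a b :=
  (hg.integrableOn_isCompact isCompact_uIcc).intervalIntegrable

variable {E : Type*} [NormedAddCommGroup E] [NormedSpace ℝ E]

/-- The average of a continuous kernel over a shrinking interval. -/
theorem tendsto_average [CompleteSpace E] {K : ℝ → ℝ → E} (hK : Continuous (Function.uncurry K)) :
    Tendsto (fun h : ℝ => h⁻¹ • ∫ s in (0 : ℝ)..h, K h s) (𝓝[>] 0) (𝓝 (K 0 0)) := by
  -- The substitution `s = h u` turns the average into an integral over the fixed interval `[0, 1]`.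
  have h1 : Continuous fun h : ℝ => ∫ u in (0 : ℝ)..1, K h (h * u) := by
    apply intervalIntegral.continuous_parametric_intervalIntegral_of_continuous'
    exact hK.comp (continuous_fst.prodMk (continuous_fst.mul continuous_snd))
  have h2 : Tendsto (fun h : ℝ => ∫ u in (0 : ℝ)..1, K h (h * u)) (𝓝[>] 0) (𝓝 (K 0 0)) := by
    have := (h1.tendsto 0).mono_left (nhdsWithin_le_nhds (s := Ioi 0))
    simpa using this
  refine h2.congr' ?_
  filter_upwards [self_mem_nhdsWithin] with h (hh : 0 < h)
  have := intervalIntegral.smul_integral_comp_mul_left (a := 0) (b := 1) (fun s => K h s) h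
  simp only [mul_zero, mul_one] at this
  rw [← this, smul_smul, inv_mul_cancel₀ hh.ne', one_smul]

theorem tendsto_average_right [CompleteSpace E] {z : ℝ → E} (hz : Continuous z) (t : ℝ) :
    Tendsto (fun h : ℝ => h⁻¹ • ∫ s in t..(t + h), z s) (𝓝[>] 0) (𝓝 (z t)) := by
  have hK : Continuous (Function.uncurry fun (_ s : ℝ) => z (s + t)) := by
    simp only [Function.uncurry_def]; fun_prop
  have := tendsto_average hK
  simpa [intervalIntegral.integral_comp_add_right, add_comm] using this

namespace C0Semigroup

variable (S : C0Semigroup E)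

/-- The semigroup with real time, constant for negative times. -/
def opReal (t : ℝ) : E →L[ℝ] E := S.op t.toNNReal

theorem opReal_of_nonpos {t : ℝ} (ht : t ≤ 0) (x : E) : S.opReal t x = x := by
  rw [opReal, Real.toNNReal_of_nonpos ht, S.op_zero]; rfl

@[simp] theorem opReal_zero (x : E) : S.opReal 0 x = x := S.opReal_of_nonpos le_rfl x

theorem opReal_add {s t : ℝ} (hs : 0 ≤ s) (ht : 0 ≤ t) (x : E) :
    S.opReal (s + t) x = S.opReal s (S.opReal t x) := by
  rw [opReal, Real.toNNReal_add hs ht, S.op_add]; rfl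

theorem tendsto_op_nhds (x : E) : Tendsto (fun t => S.op t x) (𝓝 0) (𝓝 x) := by
  have h0 : S.op 0 x = x := by rw [S.op_zero]; rfl
  have h1 : ContinuousWithinAt (fun t => S.op t x) (Ioi 0) 0 := by
    rw [ContinuousWithinAt, h0]; exact S.tendsto_op x
  have h2 := continuousWithinAt_insert_self.mpr h1
  have h3 : insert (0 : ℝ≥0) (Ioi 0) = univ := by
    ext t; simp
  rw [h3, continuousWithinAt_univ, ContinuousAt, h0] at h2
  exact h2

variable {S} in
/-- The generator in terms of real times. -/
theorem IsGenerator.mem_graph_iff {A : E →ₗ.[ℝ] E} (hA : S.IsGenerator A) {x z : E} :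
    (x, z) ∈ A.graph ↔ Tendsto (fun h : ℝ => h⁻¹ • (S.opReal h x - x)) (𝓝[>] 0) (𝓝 z) := by
  rw [hA x z, ← NNReal.coe_zero, ← NNReal.map_coe_nhdsGT, tendsto_map'_iff]
  simp [Function.comp_def, opReal]

/-- The mild solution with initial value `x` and forcing `g`. -/
def mild (x : E) (g : ℝ → E) (t : ℝ) : E :=
  S.opReal t x + ∫ s in (0 : ℝ)..t, S.opReal (t - s) (g s)

@[simp] theorem mild_zero (x : E) (g : ℝ → E) : S.mild x g 0 = x := by simp [mild]

variable [CompleteSpace E]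

/-- Otherwise `‖S (tₙ)‖ > n` along some `tₙ → 0`. But `S (tₙ) x` converges for every `x`, which
contradicts Banach–Steinhaus. -/
theorem exists_norm_le_near_zero : ∃ δ > 0, ∃ C, ∀ t ≤ δ, ‖S.op t‖ ≤ C := by
  by_contra! hcon
  have h1 (n : ℕ) : ∃ t : ℝ≥0, t ≤ 1 / ((n : ℝ≥0) + 1) ∧ (n : ℝ) < ‖S.op t‖ :=
    hcon _ (by positivity) n
  choose t ht hn using h1
  have ht0 : Tendsto t atTop (𝓝 0) :=
    tendsto_of_tendsto_of_tendsto_of_le_of_le tendsto_const_nhds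
      (tendsto_one_div_add_atTop_nhds_zero_nat (𝕜 := ℝ≥0)) (fun _ => zero_le) ht
  obtain ⟨C, hC⟩ := banach_steinhaus (g := fun n => S.op (t n)) (fun x => by
    have h2 := ((S.tendsto_op_nhds x).comp ht0)
    obtain ⟨C, hC⟩ := (Metric.isBounded_range_of_tendsto _ h2).exists_norm_le
    exact ⟨C, fun n => hC _ ⟨n, rfl⟩⟩)
  obtain ⟨n, hn'⟩ := exists_nat_gt C
  linarith [hC n, hn n]

theorem exists_norm_le (T : ℝ) : ∃ M : ℝ, 1 ≤ M ∧ ∀ t ≤ T, ‖S.opReal t‖ ≤ M := by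
  obtain ⟨δ, hδ, C, hC⟩ := S.exists_norm_le_near_zero
  -- A time `t ≤ n δ` is split into at most `n` steps of length at most `δ`.
  have key (n : ℕ) : ∀ t : ℝ≥0, t ≤ n * δ → ‖S.op t‖ ≤ max C 1 ^ n := by
    induction n with
    | zero =>
      intro t ht
      have : t = 0 := by simpa using ht
      rw [this, S.op_zero, pow_zero]
      exact ContinuousLinearMap.norm_id_le
    | succ n ih =>
      intro t ht
      rcases le_total t δ with h | h
      · calc ‖S.op t‖ ≤ max C 1 := (hC t h).trans (le_max_left _ _)
          _ ≤ max C 1 ^ (n + 1) := le_self_pow₀ (le_max_right _ _) (by omega)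
      · have h2 : t = (t - δ) + δ := (tsub_add_cancel_of_le h).symm
        rw [h2, S.op_add, pow_succ]
        refine (ContinuousLinearMap.opNorm_comp_le _ _).trans ?_
        have h3 : t - δ ≤ n * δ := by
          rw [tsub_le_iff_right]; push_cast at ht; linarith [ht]
        gcongr
        · exact ih _ h3
        · exact (hC δ le_rfl).trans (le_max_left _ _)
  obtain ⟨n, hn⟩ := exists_nat_ge (T.toNNReal / δ)
  refine ⟨max C 1 ^ n, one_le_pow₀ (le_max_right _ _), fun t ht => key n _ ?_⟩
  exact (Real.toNNReal_le_toNNReal ht).trans ((div_le_iff₀ hδ).1 hn)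

/-- For two times at distance `h` the difference of the orbits is `S` at the smaller time applied to
`S h x - x`, so continuity at `0` and the local bound suffice on both sides. -/
theorem continuous_op_apply (x : E) : Continuous fun t => S.op t x := by
  rw [continuous_iff_continuousAt]
  intro s
  obtain ⟨M, hM1, hM⟩ := S.exists_norm_le (s + 1)
  have hM' (t : ℝ≥0) (ht : t ≤ s + 1) : ‖S.op t‖ ≤ M := by
    have := hM t (by exact_mod_cast ht)
    rwa [opReal, Real.toNNReal_coe] at this
  have h1 : Tendsto (fun t => M * ‖S.op (nndist t s) x - x‖) (𝓝 s) (𝓝 0) := by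
    have h2 : Tendsto (fun t => nndist t s) (𝓝 s) (𝓝 0) := by
      have := (continuous_id.nndist (continuous_const (y := s))).tendsto s
      simpa using this
    have h3 := ((S.tendsto_op_nhds x).comp h2).sub_const x
    simpa using h3.norm.const_mul M
  rw [ContinuousAt, tendsto_iff_norm_sub_tendsto_zero]
  refine squeeze_zero' (Eventually.of_forall fun _ => norm_nonneg _) ?_ h1
  filter_upwards [Iio_mem_nhds (show s < s + 1 by simp)] with t (ht : t < s + 1)
  have hnn (u v : ℝ≥0) (huv : u ≤ v) : v = u + nndist u v := by
    ext
    have : (u : ℝ) ≤ v := huv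
    rw [NNReal.coe_add, coe_nndist, NNReal.dist_eq, abs_of_nonpos (by linarith)]
    ring
  rcases le_total t s with h | h
  · have e : S.op s x = S.op t (S.op (nndist t s) x) := by
      conv_lhs => rw [hnn t s h, S.op_add]
      rfl
    rw [e, ← map_sub, norm_sub_rev (S.op _ x)]
    exact (S.op t).le_of_opNorm_le (hM' t ht.le) _
  · have e : S.op t x = S.op s (S.op (nndist t s) x) := by
      conv_lhs => rw [hnn s t h, S.op_add, nndist_comm]
      rfl
    rw [e, ← map_sub]
    exact (S.op s).le_of_opNorm_le (hM' s (by simp)) _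

theorem continuous_opReal : Continuous fun p : ℝ × E => S.opReal p.1 p.2 := by
  rw [continuous_iff_continuousAt]
  rintro ⟨t, x⟩
  obtain ⟨M, hM1, hM⟩ := S.exists_norm_le (t + 1)
  have h1 : Tendsto (fun p : ℝ × E => S.opReal p.1 (p.2 - x)) (𝓝 (t, x)) (𝓝 0) := by
    have h2 : Tendsto (fun p : ℝ × E => M * ‖p.2 - x‖) (𝓝 (t, x)) (𝓝 0) := by
      have : Continuous fun p : ℝ × E => M * ‖p.2 - x‖ := by fun_prop
      simpa using this.tendsto (t, x)
    refine squeeze_zero_norm' ?_ h2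
    have h3 : ∀ᶠ p : ℝ × E in 𝓝 (t, x), p.1 < t + 1 :=
      continuous_fst.continuousAt.eventually (Iio_mem_nhds (by simp))
    filter_upwards [h3] with p hp
    exact (S.opReal _).le_of_opNorm_le (hM _ hp.le) _
  have h4 : Tendsto (fun p : ℝ × E => S.opReal p.1 x) (𝓝 (t, x)) (𝓝 (S.opReal t x)) :=
    (((S.continuous_op_apply x).comp continuous_real_toNNReal).comp continuous_fst).tendsto (t, x)
  have h5 := h1.add h4
  rw [zero_add] at h5
  refine h5.congr fun p => ?_
  rw [map_sub, sub_add_cancel]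

@[fun_prop]
theorem continuous_opReal_apply {X : Type*} [TopologicalSpace X] {u : X → ℝ} {v : X → E}
    (hu : Continuous u) (hv : Continuous v) : Continuous fun p => S.opReal (u p) (v p) :=
  S.continuous_opReal.comp (hu.prodMk hv)

theorem aestronglyMeasurable_opReal {α : Type*} [MeasurableSpace α] {μ : Measure α} {u : α → ℝ}
    {v : α → E} (hu : AEMeasurable u μ) (hv : AEStronglyMeasurable v μ) :
    AEStronglyMeasurable (fun p => S.opReal (u p) (v p)) μ :=
  S.continuous_opReal.comp_aestronglyMeasurable (hu.aestronglyMeasurable.prodMk hv)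

theorem intervalIntegrable_opReal {g : ℝ → E} (r : ℝ) {a b : ℝ}
    (hg : IntervalIntegrable g volume a b) :
    IntervalIntegrable (fun s => S.opReal (r - s) (g s)) volume a b := by
  obtain ⟨M, hM1, hM⟩ := S.exists_norm_le (r - min a b)
  refine (hg.norm.const_mul M).mono_fun' ?_ ?_
  · exact S.aestronglyMeasurable_opReal (by fun_prop) hg.aestronglyMeasurable_restrict_uIoc
  · filter_upwards [ae_restrict_mem measurableSet_uIoc] with s hs
    refine (S.opReal _).le_of_opNorm_le (hM _ ?_) _
    have : min a b < s := hs.1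
    linarith

theorem continuous_mild (x : E) {g : ℝ → E} (hg : LocallyIntegrable g) :
    Continuous (S.mild x g) := by
  refine Continuous.add (by fun_prop) ?_
  rw [continuous_iff_continuousAt]
  intro t
  -- Both variables are confined to `|·| ≤ |t| + 1`, so `r - s` stays below `2 (|t| + 1)`. For `s >
  -- r` the integrand is defined since `opReal` is the identity at negative times.
  obtain ⟨M, hM1, hM⟩ := S.exists_norm_le (2 * (|t| + 1))
  have h := intervalIntegral.continuousAt_parametric_primitive_of_dominated (μ := volume)
    (F := fun r s => S.opReal (r - s) (g s)) (fun s => M * ‖g s‖) (-(|t| + 1)) (|t| + 1)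
    (a₀ := 0) (b₀ := t) (x₀ := t)
    (fun r => S.aestronglyMeasurable_opReal (by fun_prop) hg.aestronglyMeasurable.restrict)
    (by
      have : ∀ᶠ r in 𝓝 t, r < |t| + 1 := Iio_mem_nhds (by linarith [le_abs_self t])
      filter_upwards [this] with r hr
      filter_upwards [ae_restrict_mem measurableSet_uIoc] with s hs
      rw [uIoc_of_le (by linarith [abs_nonneg t])] at hs
      exact (S.opReal _).le_of_opNorm_le (hM _ (by linarith [hs.1])) _)
    ((intervalIntegrable_of_locallyIntegrable hg _ _).norm.const_mul M)
    (Eventually.of_forall fun s => Continuous.continuousAt (by fun_prop))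
    ⟨by linarith [abs_nonneg t], by linarith [abs_nonneg t]⟩
    ⟨by linarith [neg_abs_le t], by linarith [le_abs_self t]⟩ (by simp)
  exact ContinuousAt.comp (f := fun r : ℝ => (r, r)) h (by fun_prop)

end C0Semigroup

end Semigroup

/-! ### Mild solutions and integrated solutions -/

section Integrated

theorem locallyIntegrable_comp_add {E : Type*} [NormedAddCommGroup E] {g : ℝ → E}
    (hg : LocallyIntegrable g) (r : ℝ) :
    LocallyIntegrable (fun s => g (s + r)) := by
  intro x
  have h := hg (x + r)
  obtain ⟨U, hU, hgU⟩ := h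
  have hmp : MeasurePreserving (fun s : ℝ => s + r) volume volume := measurePreserving_add_right _ r
  refine ⟨(fun s => s + r) ⁻¹' U, (by fun_prop : Continuous fun s : ℝ => s + r).continuousAt hU, ?_⟩
  exact (hmp.integrableOn_comp_preimage (Homeomorph.addRight r).measurableEmbedding).2 hgU

theorem aestronglyMeasurable_comp_add_prod {E : Type*} [NormedAddCommGroup E]
    {g : ℝ → E} (hg : LocallyIntegrable g) :
    AEStronglyMeasurable (fun p : ℝ × ℝ => g (p.1 + p.2)) (volume.prod volume) :=
  (hg.aestronglyMeasurable.comp_snd (μ := (volume : Measure ℝ))).comp_measurePreserving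
    (measurePreserving_prod_add volume volume)

variable {E : Type*} [NormedAddCommGroup E] [NormedSpace ℝ E] [CompleteSpace E]

namespace C0Semigroup

variable (S : C0Semigroup E)

/-- Restarting at time `r` with the shifted forcing continues the same solution; this is the
semigroup law applied under the integral. -/
theorem mild_add (x : E) {g : ℝ → E} (hg : LocallyIntegrable g) {r h : ℝ} (hr : 0 ≤ r)
    (hh : 0 ≤ h) :
    S.mild x g (r + h) = S.mild (S.mild x g r) (fun s => g (s + r)) h := by
  have hi (a b : ℝ) : IntervalIntegrable (fun s => S.opReal (r + h - s) (g s)) volume a b :=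
    S.intervalIntegrable_opReal _ (intervalIntegrable_of_locallyIntegrable hg _ _)
  rw [mild, mild, mild, ← intervalIntegral.integral_add_adjacent_intervals (hi 0 r) (hi r (r + h)),
    map_add, add_comm r h, S.opReal_add hh hr, ← ContinuousLinearMap.intervalIntegral_comp_comm _
      (S.intervalIntegrable_opReal r (intervalIntegrable_of_locallyIntegrable hg _ _)), add_assoc]
  congr 1
  congr 1
  · apply intervalIntegral.integral_congr
    intro s hs
    rw [uIcc_of_le hr] at hs
    dsimp only
    rw [← S.opReal_add hh (by linarith [hs.2]), add_sub_assoc]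
  · have := intervalIntegral.integral_comp_add_right (a := 0) (b := h)
      (fun s => S.opReal (h + r - s) (g s)) r
    rw [zero_add] at this
    rw [← this]
    congr 1; ext s; congr 2; ring

/-- The exchange of integrals replaces the merely integrable `g` by the continuous moving integral
`∫ r in s..(s + t), g r`, to which `tendsto_average` applies. -/
theorem integral_integral_opReal {g : ℝ → E} (hg : LocallyIntegrable g) {t h : ℝ} (ht : 0 ≤ t)
    (hh : 0 ≤ h) :
    ∫ r in (0 : ℝ)..t, ∫ s in (0 : ℝ)..h, S.opReal (h - s) (g (s + r)) =
      ∫ s in (0 : ℝ)..h, S.opReal (h - s) (∫ r in s..(s + t), g r) := by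
  obtain ⟨M, hM1, hM⟩ := S.exists_norm_le h
  have hgi := fun a b => intervalIntegrable_of_locallyIntegrable hg a b
  have hmeas : AEStronglyMeasurable (fun p : ℝ × ℝ => g (p.2 + p.1))
      ((volume.restrict (Ioc 0 t)).prod (volume.restrict (Ioc 0 h))) := by
    rw [Measure.prod_restrict]
    have := (aestronglyMeasurable_comp_add_prod hg).restrict (s := Ioc 0 t ×ˢ Ioc 0 h)
    simpa only [add_comm] using this
  have hint : Integrable (fun p : ℝ × ℝ => g (p.2 + p.1))
      ((volume.restrict (Ioc 0 t)).prod (volume.restrict (Ioc 0 h))) := by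
    rw [integrable_prod_iff' hmeas]
    constructor
    · refine Eventually.of_forall fun s => ?_
      have := intervalIntegrable_of_locallyIntegrable (locallyIntegrable_comp_add hg s) 0 t
      rw [intervalIntegrable_iff_integrableOn_Ioc_of_le ht] at this
      simpa only [add_comm, IntegrableOn] using this
    · have hc : Continuous fun s => ∫ r in s..(s + t), ‖g r‖ := by
        have h1 : Continuous fun s => ∫ r in (0 : ℝ)..s, ‖g r‖ :=
          intervalIntegral.continuous_primitive (fun a b => (hgi a b).norm) 0
        have h2 : Continuous fun s => (∫ r in (0 : ℝ)..(s + t), ‖g r‖) - ∫ r in (0 : ℝ)..s, ‖g r‖ :=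
          (h1.comp (by fun_prop : Continuous fun s : ℝ => s + t)).sub h1
        refine h2.congr fun s => ?_
        rw [intervalIntegral.integral_interval_sub_left (hgi _ _).norm (hgi _ _).norm]
      have := (hc.intervalIntegrable (μ := volume) 0 h)
      rw [intervalIntegrable_iff_integrableOn_Ioc_of_le hh] at this
      refine this.congr (Eventually.of_forall fun s => ?_)
      dsimp only
      rw [← intervalIntegral.integral_of_le ht,
        intervalIntegral.integral_comp_add_left (fun r => ‖g r‖) s, add_zero]
  have hint2 : Integrable (Function.uncurry fun r s : ℝ => S.opReal (h - s) (g (s + r)))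
      ((volume.restrict (Ioc 0 t)).prod (volume.restrict (Ioc 0 h))) := by
    refine (hint.norm.const_mul M).mono' ?_ ?_
    · exact S.aestronglyMeasurable_opReal (by fun_prop) hmeas
    · rw [Measure.prod_restrict]
      filter_upwards [ae_restrict_mem (measurableSet_Ioc.prod measurableSet_Ioc)] with p hp
      exact (S.opReal _).le_of_opNorm_le (hM _ (by linarith [hp.2.1])) _
  simp only [intervalIntegral.integral_of_le ht, intervalIntegral.integral_of_le hh]
  rw [integral_integral_swap hint2]
  refine integral_congr_ae (Eventually.of_forall fun s => ?_)
  dsimp only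
  rw [← intervalIntegral.integral_of_le ht, ContinuousLinearMap.intervalIntegral_comp_comm]
  · rw [intervalIntegral.integral_comp_add_left g s, add_zero]
  · have := intervalIntegrable_of_locallyIntegrable (locallyIntegrable_comp_add hg s) 0 t
    simpa only [add_comm] using this

variable {S}

/-- The primitive of a mild solution belongs to the domain of the generator. -/
theorem tendsto_integral_mild {x : E} {g z : ℝ → E} (hg : LocallyIntegrable g) (hz : Continuous z)
    (hzg : ∀ t, 0 ≤ t → z t = S.mild x g t) {t : ℝ} (ht : 0 ≤ t) :
    Tendsto (fun h : ℝ => h⁻¹ • (S.opReal h (∫ s in (0 : ℝ)..t, z s) - ∫ s in (0 : ℝ)..t, z s))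
      (𝓝[>] 0) (𝓝 (z t - x - ∫ s in (0 : ℝ)..t, g s)) := by
  have hgi := fun a b => intervalIntegrable_of_locallyIntegrable hg a b
  have hzi := fun a b => hz.intervalIntegrable (μ := volume) a b
  have hG : Continuous fun s => ∫ r in s..(s + t), g r := by
    have h1 : Continuous fun s => ∫ r in (0 : ℝ)..s, g r :=
      intervalIntegral.continuous_primitive hgi 0
    have h2 : Continuous fun s => (∫ r in (0 : ℝ)..(s + t), g r) - ∫ r in (0 : ℝ)..s, g r :=
      (h1.comp (by fun_prop : Continuous fun s : ℝ => s + t)).sub h1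
    refine h2.congr fun s => ?_
    rw [intervalIntegral.integral_interval_sub_left (hgi _ _) (hgi _ _)]
  have hK : Continuous (Function.uncurry fun h s : ℝ =>
      S.opReal (h - s) (∫ r in s..(s + t), g r)) := by
    exact S.continuous_opReal_apply (by fun_prop) (hG.comp continuous_snd)
  have h0 : z 0 = x := by rw [hzg 0 le_rfl, mild_zero]
  -- By `mild_add`, `S h (z r) = z (r + h) - ∫₀ʰ S (h - s) g (s + r) ds`. Integrated over `r`, the
  -- increment `S h X - X` of the primitive is the integral of `z` over `[t, t + h]`, minus that
  -- over `[0, h]`, minus the exchanged double integral. These are the three averages whose limits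
  -- are taken here.
  have hlim := ((tendsto_average_right hz t).sub (tendsto_average_right hz 0)).sub
    (tendsto_average hK)
  simp only [zero_add, sub_zero, opReal_zero, h0] at hlim
  refine hlim.congr' ?_
  filter_upwards [self_mem_nhdsWithin] with h (hh : 0 < h)
  rw [← smul_sub, ← smul_sub]
  congr 1
  have e1 : S.opReal h (∫ s in (0 : ℝ)..t, z s) = ∫ r in (0 : ℝ)..t,
      (z (r + h) - ∫ s in (0 : ℝ)..h, S.opReal (h - s) (g (s + r))) := by
    rw [← ContinuousLinearMap.intervalIntegral_comp_comm _ (hzi _ _)]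
    apply intervalIntegral.integral_congr
    intro r hr
    rw [uIcc_of_le ht] at hr
    dsimp only
    rw [hzg (r + h) (by linarith [hr.1]), S.mild_add x hg hr.1 hh.le, ← hzg r hr.1, mild,
      add_sub_cancel_right]
  have hc : ∀ r ∈ uIcc 0 t, (∫ s in (0 : ℝ)..h, S.opReal (h - s) (g (s + r))) =
      z (r + h) - S.opReal h (z r) := by
    intro r hr
    rw [uIcc_of_le ht] at hr
    rw [hzg (r + h) (by linarith [hr.1]), S.mild_add x hg hr.1 hh.le, ← hzg r hr.1, mild,
      add_sub_cancel_left]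
  have hi1 : IntervalIntegrable (fun r => z (r + h)) volume 0 t :=
    (by fun_prop : Continuous fun r => z (r + h)).intervalIntegrable _ _
  have hi2 : IntervalIntegrable (fun r => ∫ s in (0 : ℝ)..h, S.opReal (h - s) (g (s + r)))
      volume 0 t := by
    have : IntervalIntegrable (fun r => z (r + h) - S.opReal h (z r)) volume 0 t :=
      (by fun_prop : Continuous fun r => z (r + h) - S.opReal h (z r)).intervalIntegrable _ _
    exact this.congr fun r hr => (hc r (uIoc_subset_uIcc hr)).symm
  rw [e1, intervalIntegral.integral_sub hi1 hi2, S.integral_integral_opReal hg ht hh.le,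
    intervalIntegral.integral_comp_add_right, zero_add]
  rw [intervalIntegral.integral_interval_sub_interval_comm' (hzi t (t + h)) (hzi 0 h) (hzi t 0)]
  abel

theorem IsGenerator.integral_mem_graph {A : E →ₗ.[ℝ] E} (hA : S.IsGenerator A) {x : E}
    {g z : ℝ → E} (hg : LocallyIntegrable g) (hz : Continuous z)
    (hzg : ∀ t, 0 ≤ t → z t = S.mild x g t) {t : ℝ} (ht : 0 ≤ t) :
    (∫ s in (0 : ℝ)..t, z s, z t - x - ∫ s in (0 : ℝ)..t, g s) ∈ A.graph :=
  hA.mem_graph_iff.2 (tendsto_integral_mild hg hz hzg ht)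

/-- The abstract Cauchy problem has only the zero solution with zero initial value. -/
theorem IsGenerator.eq_zero_of_hasDerivAt {A : E →ₗ.[ℝ] E} (hA : S.IsGenerator A) {X X' : ℝ → E}
    (hX : ∀ t, HasDerivAt X (X' t) t) (hXA : ∀ t, 0 ≤ t → (X t, X' t) ∈ A.graph) (h0 : X 0 = 0)
    {t : ℝ} (ht : 0 ≤ t) : X t = 0 := by
  have hXc : Continuous X := continuous_iff_continuousAt.2 fun t => (hX t).continuousAt
  -- The curve `s ↦ S (t - s) (X s)` joins `S t (X 0) = 0` to `X t`. Its right derivative is `S (t -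
  -- s) (X' s - A X s) = 0`, and a right derivative is enough for constancy.
  have key := constant_of_has_deriv_right_zero (f := fun s => S.opReal (t - s) (X s)) (a := 0)
    (b := t) (by fun_prop) (by
      intro s hs
      rw [← hasDerivWithinAt_Ioi_iff_Ici, hasDerivWithinAt_iff_tendsto_slope' self_notMem_Ioi]
      have hl1 : Tendsto (fun r => (r - s)⁻¹ • (X r - X s)) (𝓝[>] s) (𝓝 (X' s)) :=
        (hasDerivWithinAt_iff_tendsto_slope' self_notMem_Ioi).1 (hX s).hasDerivWithinAt
      have hsub : Tendsto (fun r => r - s) (𝓝[>] s) (𝓝[>] 0) := by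
        refine tendsto_nhdsWithin_iff.2 ⟨?_, ?_⟩
        · have : Continuous fun r => r - s := by fun_prop
          simpa using (this.tendsto s).mono_left nhdsWithin_le_nhds
        · filter_upwards [self_mem_nhdsWithin] with r (hr : s < r)
          exact sub_pos.2 hr
      have hl2 := (hA.mem_graph_iff.1 (hXA s hs.1)).comp hsub
      have hl3 := hl1.sub hl2
      rw [sub_self] at hl3
      have hl4 : Tendsto (fun r => t - r) (𝓝[>] s) (𝓝 (t - s)) :=
        ((by fun_prop : Continuous fun r : ℝ => t - r).tendsto s).mono_left nhdsWithin_le_nhds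
      have hl5 := (S.continuous_opReal.tendsto (t - s, 0)).comp (hl4.prodMk_nhds hl3)
      simp only [map_zero] at hl5
      refine hl5.congr' ?_
      filter_upwards [self_mem_nhdsWithin, mem_nhdsWithin_of_mem_nhds (Iio_mem_nhds hs.2)]
        with r (hr : s < r) (hrt : r < t)
      have e : t - s = (t - r) + (r - s) := by ring
      simp only [Function.comp_apply, slope, vsub_eq_sub]
      rw [e, S.opReal_add (by linarith) (by linarith), ← map_sub, ← smul_sub, map_smul]
      congr 2
      abel) t ⟨ht, le_rfl⟩
  simpa [h0] using key

/-- An integrated solution is a mild solution. -/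
theorem IsGenerator.eq_mild {A : E →ₗ.[ℝ] E} (hA : S.IsGenerator A) {x : E}
    {g z : ℝ → E} (hg : LocallyIntegrable g) (hz : Continuous z)
    (hzA : ∀ t, 0 ≤ t → (∫ s in (0 : ℝ)..t, z s, z t - x - ∫ s in (0 : ℝ)..t, g s) ∈ A.graph)
    {t : ℝ} (ht : 0 ≤ t) : z t = S.mild x g t := by
  have hm := S.continuous_mild x hg
  have hw : Continuous fun s => z s - S.mild x g s := hz.sub hm
  -- The primitive of the difference of two integrated solutions is a classical solution of the
  -- homogeneous Cauchy problem, hence zero; the difference itself is then `A 0 = 0`.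
  have hX (t : ℝ) : HasDerivAt (fun t => ∫ s in (0 : ℝ)..t, (z s - S.mild x g s))
      (z t - S.mild x g t) t :=
    intervalIntegral.integral_hasDerivAt_right (hw.intervalIntegrable _ _)
      (hw.stronglyMeasurableAtFilter _ _) hw.continuousAt
  have hXA (t : ℝ) (ht : 0 ≤ t) :
      (∫ s in (0 : ℝ)..t, (z s - S.mild x g s), z t - S.mild x g t) ∈ A.graph := by
    have h := A.graph.sub_mem (hzA t ht) (hA.integral_mem_graph hg hm (fun _ _ => rfl) ht)
    rw [intervalIntegral.integral_sub (hz.intervalIntegrable _ _) (hm.intervalIntegrable _ _)]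
    convert h using 1
    ext <;> simp
  have h0 (t : ℝ) (ht : 0 ≤ t) : ∫ s in (0 : ℝ)..t, (z s - S.mild x g s) = 0 :=
    hA.eq_zero_of_hasDerivAt hX hXA (by simp) ht
  have h1 : (0, z t - S.mild x g t) ∈ A.graph := by
    have := hXA t ht
    rwa [h0 t ht] at this
  exact sub_eq_zero.1 (A.graph_fst_eq_zero_snd h1 rfl)

/-- The averages `h⁻¹ ∫₀ʰ S s x ds` lie in the domain and tend to `x`. -/
theorem IsGenerator.dense_domain {A : E →ₗ.[ℝ] E} (hA : S.IsGenerator A) :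
    Dense (A.domain : Set E) := by
  intro x
  have hc : Continuous fun t => S.opReal t x := by fun_prop
  have hl := tendsto_average_right hc 0
  simp only [zero_add, opReal_zero] at hl
  refine mem_closure_of_tendsto hl ?_
  filter_upwards [self_mem_nhdsWithin] with h (hh : 0 < h)
  refine A.domain.smul_mem _ ?_
  have := hA.integral_mem_graph (x := x) (g := fun _ => 0) (z := fun t => S.opReal t x)
    (locallyIntegrable_const 0) hc (fun t ht => by simp [mild]) hh.le
  exact LinearPMap.mem_domain_of_mem_graph this

/-- A semigroup is determined by its generator. -/
theorem IsGenerator.opReal_eq {S' : C0Semigroup E} {A : E →ₗ.[ℝ] E} (hA : S.IsGenerator A)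
    (hA' : S'.IsGenerator A) {t : ℝ} (ht : 0 ≤ t) (x : E) : S'.opReal t x = S.opReal t x := by
  have hc : Continuous fun t => S'.opReal t x := by fun_prop
  have h := hA.eq_mild (x := x) (g := fun _ => 0) (z := fun t => S'.opReal t x)
    (locallyIntegrable_const 0) hc
    (fun s hs => hA'.integral_mem_graph (locallyIntegrable_const 0) hc
      (fun t ht => by simp [mild]) hs) ht
  simpa [mild] using h

end C0Semigroup

end Integrated

/-! ### Semilinear equations -/

section Semilinear

theorem le_mul_exp_of_le_add_integral {u : ℝ → ℝ} {a C T : ℝ} (hu : Continuous u) (hC : 0 ≤ C)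
    (h : ∀ t ∈ Icc 0 T, u t ≤ a + C * ∫ s in (0 : ℝ)..t, u s) {t : ℝ} (ht : t ∈ Icc 0 T) :
    u t ≤ a * Real.exp (C * t) := by
  have hF (t : ℝ) : HasDerivAt (fun t => a + C * ∫ s in (0 : ℝ)..t, u s) (C * u t) t :=
    ((intervalIntegral.integral_hasDerivAt_right (hu.intervalIntegrable _ _)
      (hu.stronglyMeasurableAtFilter _ _) hu.continuousAt).const_mul C).const_add a
  have := le_gronwallBound_of_liminf_deriv_right_le (f := fun t => a + C * ∫ s in (0 : ℝ)..t, u s)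
    (f' := fun t => C * u t) (δ := a) (K := C) (ε := 0) (a := 0) (b := T)
    (fun t _ => (hF t).continuousAt.continuousWithinAt)
    (fun t _ r hr => (hF t).hasDerivWithinAt.liminf_right_slope_le hr) (by simp)
    (fun t ht => by
      rw [add_zero]
      exact mul_le_mul_of_nonneg_left (h t ⟨ht.1, ht.2.le⟩) hC) t ht
  rw [gronwallBound_ε0, sub_zero] at this
  exact (h t ht).trans this

variable {E : Type*} [NormedAddCommGroup E] [NormedSpace ℝ E] [CompleteSpace E]

namespace C0Semigroup

variable (S : C0Semigroup E)

/-- The basic stability estimate, by Grönwall. The slack `a` in the forcing is zero for uniqueness,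
comes from the difference of the inputs for continuous dependence, and comes from the initial value
for the bound on perturbed semigroups. -/
theorem norm_sub_le_of_integral_eq {T M a L : ℝ} (hM : ∀ t ≤ T, ‖S.opReal t‖ ≤ M) (ha : 0 ≤ a)
    (hL : 0 ≤ L) {h g₁ g₂ z₁ z₂ : ℝ → E} (hz₁ : Continuous z₁) (hz₂ : Continuous z₂)
    (hg₁ : IntervalIntegrable g₁ volume 0 T) (hg₂ : IntervalIntegrable g₂ volume 0 T)
    (e₁ : ∀ t ∈ Icc 0 T, z₁ t = h t + ∫ s in (0 : ℝ)..t, S.opReal (t - s) (g₁ s))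
    (e₂ : ∀ t ∈ Icc 0 T, z₂ t = h t + ∫ s in (0 : ℝ)..t, S.opReal (t - s) (g₂ s))
    (hg : ∀ s ∈ Icc 0 T, ‖g₁ s - g₂ s‖ ≤ a + L * ‖z₁ s - z₂ s‖) {t : ℝ} (ht : t ∈ Icc 0 T) :
    ‖z₁ t - z₂ t‖ ≤ M * a * T * Real.exp (M * L * t) := by
  have hM0 : 0 ≤ M := (norm_nonneg _).trans (hM T le_rfl)
  have hu : Continuous fun t => ‖z₁ t - z₂ t‖ := (hz₁.sub hz₂).norm
  refine le_mul_exp_of_le_add_integral hu (mul_nonneg hM0 hL) (fun t ht => ?_) ht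
  have hsub : uIcc 0 t ⊆ uIcc 0 T := by
    rw [uIcc_of_le ht.1, uIcc_of_le (ht.1.trans ht.2)]; exact Icc_subset_Icc_right ht.2
  have hi₁ := S.intervalIntegrable_opReal t (hg₁.mono_set hsub)
  have hi₂ := S.intervalIntegrable_opReal t (hg₂.mono_set hsub)
  rw [e₁ t ht, e₂ t ht, add_sub_add_left_eq_sub, ← intervalIntegral.integral_sub hi₁ hi₂]
  have hc : Continuous fun s => M * a + M * L * ‖z₁ s - z₂ s‖ := by fun_prop
  calc _ ≤ ∫ s in (0 : ℝ)..t, (M * a + M * L * ‖z₁ s - z₂ s‖) := by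
        refine intervalIntegral.norm_integral_le_of_norm_le ht.1
          (Eventually.of_forall fun s hs => ?_) (hc.intervalIntegrable _ _)
        rw [← map_sub, mul_assoc, ← mul_add]
        refine ((S.opReal _).le_opNorm _).trans ?_
        gcongr
        · exact hM _ (by linarith [hs.1, ht.2])
        · exact hg s ⟨hs.1.le, hs.2.trans ht.2⟩
    _ = M * a * t + M * L * ∫ s in (0 : ℝ)..t, ‖z₁ s - z₂ s‖ := by
        rw [intervalIntegral.integral_add (continuous_const.intervalIntegrable _ _)
            (Continuous.intervalIntegrable (by fun_prop) _ _),
          intervalIntegral.integral_const, intervalIntegral.integral_const_mul, smul_eq_mul]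
        ring
    _ ≤ _ := by
        gcongr
        exact ht.2

variable {G : ℝ → E → E} {L : ℝ}

theorem eqOn_of_integral_eq (hL0 : 0 ≤ L) (hL : ∀ s z w, ‖G s z - G s w‖ ≤ L * ‖z - w‖)
    {T : ℝ} {h z₁ z₂ : ℝ → E} (hz₁ : Continuous z₁) (hz₂ : Continuous z₂)
    (hg₁ : IntervalIntegrable (fun s => G s (z₁ s)) volume 0 T)
    (hg₂ : IntervalIntegrable (fun s => G s (z₂ s)) volume 0 T)
    (e₁ : ∀ t ∈ Icc 0 T, z₁ t = h t + ∫ s in (0 : ℝ)..t, S.opReal (t - s) (G s (z₁ s)))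
    (e₂ : ∀ t ∈ Icc 0 T, z₂ t = h t + ∫ s in (0 : ℝ)..t, S.opReal (t - s) (G s (z₂ s))) :
    EqOn z₁ z₂ (Icc 0 T) := by
  intro t ht
  obtain ⟨M, -, hM⟩ := S.exists_norm_le T
  have := S.norm_sub_le_of_integral_eq hM le_rfl hL0 hz₁ hz₂ hg₁ hg₂ e₁ e₂
    (fun s _ => by simpa using hL s _ _) ht
  rw [mul_zero, zero_mul, zero_mul] at this
  exact sub_eq_zero.1 (norm_le_zero_iff.1 this)

variable (hG : Continuous (Function.uncurry G)) (hL0 : 0 ≤ L)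
  (hL : ∀ s z w, ‖G s z - G s w‖ ≤ L * ‖z - w‖) {h : ℝ → E} (hh : Continuous h)
include hG hL0 hL hh

theorem exists_integral_eq_on {T : ℝ} (hT : 0 ≤ T) : ∃ z : ℝ → E, Continuous z ∧
    ∀ t ∈ Icc 0 T, z t = h t + ∫ s in (0 : ℝ)..t, S.opReal (t - s) (G s (z s)) := by
  obtain ⟨M, hM1, hM⟩ := S.exists_norm_le T
  -- In the unknown `w t = e^(-l t) z t` the integral operator contracts with constant `M L / l <
  -- 1`, so a single fixed point argument covers the whole interval `[0, T]`.
  set l : ℝ := M * L + 1 with hl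
  have hML : 0 ≤ M * L := by positivity
  have hl0 : 0 < l := by positivity
  let ext (w : C(Icc (0 : ℝ) T, E)) (s : ℝ) : E := Real.exp (l * s) • w (projIcc 0 T hT s)
  have hext (w) : Continuous (ext w) := by
    have : Continuous fun s => w (projIcc 0 T hT s) := w.continuous.comp continuous_projIcc
    exact Continuous.smul (by fun_prop) this
  have hGw (w) : Continuous fun s => G s (ext w s) := hG.comp (continuous_id.prodMk (hext w))
  have hint (w) : Continuous fun t => ∫ s in (0 : ℝ)..t, S.opReal (t - s) (G s (ext w s)) := by
    apply intervalIntegral.continuous_parametric_intervalIntegral_of_continuous _ continuous_id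
    exact S.continuous_opReal_apply (by fun_prop) ((hGw w).comp continuous_snd)
  let Φ (w : C(Icc (0 : ℝ) T, E)) : C(Icc (0 : ℝ) T, E) :=
    ⟨fun t => Real.exp (-(l * t)) •
      (h t + ∫ s in (0 : ℝ)..t, S.opReal (t - s) (G s (ext w s))), by
      have := hint w
      fun_prop⟩
  have hΦ : ContractingWith (M * L / l).toNNReal Φ := by
    refine ⟨?_, LipschitzWith.of_dist_le_mul fun w v => ?_⟩
    · rw [Real.toNNReal_lt_one, div_lt_one hl0, hl]; linarith
    · rw [Real.coe_toNNReal _ (by positivity), ContinuousMap.dist_le (by positivity)]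
      rintro ⟨t, ht⟩
      rw [dist_eq_norm]
      have hi (w) := S.intervalIntegrable_opReal t ((hGw w).intervalIntegrable (μ := volume) 0 t)
      change ‖Real.exp (-(l * t)) • (h t + _) - Real.exp (-(l * t)) • (h t + _)‖ ≤ _
      rw [← smul_sub, add_sub_add_left_eq_sub, norm_smul, Real.norm_eq_abs, Real.abs_exp,
        ← intervalIntegral.integral_sub (hi w) (hi v)]
      have hb : ‖∫ s in (0 : ℝ)..t, (S.opReal (t - s) (G s (ext w s)) -
          S.opReal (t - s) (G s (ext v s)))‖ ≤
          ∫ s in (0 : ℝ)..t, M * L * dist w v * Real.exp (l * s) := by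
        refine intervalIntegral.norm_integral_le_of_norm_le ht.1
          (Eventually.of_forall fun s hs => ?_) (Continuous.intervalIntegrable (by fun_prop) _ _)
        rw [← map_sub]
        refine ((S.opReal _).le_of_opNorm_le (hM _ (by linarith [hs.1, ht.2])) _).trans ?_
        rw [mul_assoc M, mul_assoc M]
        refine mul_le_mul_of_nonneg_left ((hL _ _ _).trans ?_) (by positivity)
        rw [mul_assoc]
        refine mul_le_mul_of_nonneg_left ?_ hL0
        simp only [ext]
        rw [← smul_sub, norm_smul, Real.norm_eq_abs, Real.abs_exp, mul_comm, ← dist_eq_norm]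
        gcongr
        exact ContinuousMap.dist_apply_le_dist _
      refine (mul_le_mul_of_nonneg_left hb (Real.exp_pos _).le).trans ?_
      rw [intervalIntegral.integral_const_mul, intervalIntegral.integral_comp_mul_left _ hl0.ne',
        integral_exp, mul_zero, Real.exp_zero, smul_eq_mul, Real.exp_neg]
      have he := Real.exp_pos (l * t)
      have e1 : (Real.exp (l * t))⁻¹ * (M * L * dist w v * (l⁻¹ * (Real.exp (l * t) - 1))) =
          M * L / l * dist w v * (1 - (Real.exp (l * t))⁻¹) := by
        field_simp
      rw [e1]
      refine mul_le_of_le_one_right (by positivity) ?_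
      linarith [inv_pos.2 he]
  obtain ⟨w, hw⟩ : ∃ w, Φ w = w := ⟨_, hΦ.fixedPoint_isFixedPt⟩
  refine ⟨ext w, hext w, fun t ht => ?_⟩
  have h1 : w ⟨t, ht⟩ = Real.exp (-(l * t)) •
      (h t + ∫ s in (0 : ℝ)..t, S.opReal (t - s) (G s (ext w s))) := by
    conv_lhs => rw [← hw]
    rfl
  change Real.exp (l * t) • w (projIcc 0 T hT t) = _
  rw [projIcc_of_mem hT ht, h1, smul_smul, ← Real.exp_add, add_neg_cancel, Real.exp_zero, one_smul]

/-- Global existence for semilinear equations with a globally Lipschitz nonlinearity. -/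
theorem exists_integral_eq : ∃ z : ℝ → E, Continuous z ∧
    ∀ t, 0 ≤ t → z t = h t + ∫ s in (0 : ℝ)..t, S.opReal (t - s) (G s (z s)) := by
  have hex (n : ℕ) := S.exists_integral_eq_on hG hL0 hL hh (T := n + 1) (by positivity)
  choose z hz e using hex
  have hGz (n : ℕ) : Continuous fun s => G s (z n s) := hG.comp (continuous_id.prodMk (hz n))
  have hagree {m n : ℕ} (hmn : m ≤ n) : EqOn (z m) (z n) (Icc 0 (m + 1)) :=
    S.eqOn_of_integral_eq hL0 hL (hz m) (hz n) ((hGz m).intervalIntegrable _ _)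
      ((hGz n).intervalIntegrable _ _) (e m) fun t ht => e n t ⟨ht.1, ht.2.trans (by gcongr)⟩
  have hval {n : ℕ} {t : ℝ} (ht : t < n + 1) : z ⌊t⌋₊ (max t 0) = z n (max t 0) := by
    refine hagree ?_ ⟨le_max_right _ _, max_le (Nat.lt_floor_add_one t).le (by positivity)⟩
    have : ⌊t⌋₊ < n + 1 := (Nat.floor_lt' (by omega)).2 (by exact_mod_cast ht)
    omega
  -- The solutions `z n` on `[0, n + 1]` agree where they overlap; near `t` the glued function
  -- equals the single continuous function `z ⌊t⌋₊ (max · 0)`.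
  refine ⟨fun t => z ⌊t⌋₊ (max t 0), ?_, fun t ht => ?_⟩
  · rw [continuous_iff_continuousAt]
    intro t
    have hc : Continuous fun r => z ⌊t⌋₊ (max r 0) := (hz _).comp (by fun_prop)
    refine hc.continuousAt.congr ?_
    filter_upwards [Iio_mem_nhds (Nat.lt_floor_add_one t)] with r hr
    exact (hval hr).symm
  · dsimp only
    rw [max_eq_left ht, e _ t ⟨ht, (Nat.lt_floor_add_one t).le⟩]
    congr 1
    apply intervalIntegral.integral_congr
    intro s hs
    rw [uIcc_of_le ht] at hs
    have := hval (hs.2.trans_lt (Nat.lt_floor_add_one t))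
    dsimp only
    rw [this, max_eq_left hs.1]

end C0Semigroup

end Semilinear

/-! ### Bounded perturbations and conjugation of semigroups -/

section Perturbation

variable {E : Type*} [NormedAddCommGroup E] [NormedSpace ℝ E]

namespace C0Semigroup

/-- The semigroup induced on a complemented invariant subspace. -/
def conj {F : Type*} [NormedAddCommGroup F] [NormedSpace ℝ F] (T : C0Semigroup E) (P : E →L[ℝ] F)
    (W : F →L[ℝ] E) (hPW : ∀ η, P (W η) = η)
    (hT : ∀ t η, W (P (T.op t (W η))) = T.op t (W η)) : C0Semigroup F where
  op t := P.comp ((T.op t).comp W)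
  op_zero := by ext η; simp [T.op_zero, hPW]
  op_add s t := by ext η; simp [T.op_add, hT]
  tendsto_op η := by
    have := (P.continuous.tendsto _).comp (T.tendsto_op (W η))
    rwa [hPW] at this

/-- The two difference quotients are carried into each other by `W` and `P`, so convergence in
either space implies it in the other. -/
theorem tendsto_conj_iff {F : Type*} [NormedAddCommGroup F] [NormedSpace ℝ F]
    {T : C0Semigroup E} {P : E →L[ℝ] F} {W : F →L[ℝ] E} (hPW : ∀ η, P (W η) = η)
    (hT : ∀ t η, W (P (T.op t (W η))) = T.op t (W η)) (η ζ : F) :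
    Tendsto (fun h : ℝ≥0 => (h : ℝ)⁻¹ • ((T.conj P W hPW hT).op h η - η)) (𝓝[>] 0) (𝓝 ζ) ↔
      Tendsto (fun h : ℝ => h⁻¹ • (T.opReal h (W η) - W η)) (𝓝[>] 0) (𝓝 (W ζ)) := by
  rw [← NNReal.coe_zero, ← NNReal.map_coe_nhdsGT, tendsto_map'_iff]
  constructor
  · intro h
    refine ((W.continuous.tendsto _).comp h).congr fun t => ?_
    simp [conj, hT, opReal, map_sub]
  · intro h
    have := (P.continuous.tendsto _).comp h
    rw [hPW] at this
    refine this.congr fun t => ?_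
    simp [conj, opReal, map_sub, hPW]

end C0Semigroup

variable [CompleteSpace E]

namespace C0Semigroup

variable (S : C0Semigroup E) (B : E →L[ℝ] E)

theorem eq_of_mild_perturbed {x : E} {z w : ℝ → E} (hz : Continuous z) (hw : Continuous w)
    (ez : ∀ t, 0 ≤ t → z t = S.mild x (fun s => B (z s)) t)
    (ew : ∀ t, 0 ≤ t → w t = S.mild x (fun s => B (w s)) t) {t : ℝ} (ht : 0 ≤ t) : z t = w t :=
  S.eqOn_of_integral_eq (G := fun _ z => B z) (L := ‖B‖) (norm_nonneg _)
    (fun s z w => by rw [← map_sub]; exact B.le_opNorm _) (h := fun t => S.opReal t x) hz hw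
    (Continuous.intervalIntegrable (by fun_prop) _ _)
    (Continuous.intervalIntegrable (by fun_prop) _ _)
    (fun t ht => ez t ht.1) (fun t ht => ew t ht.1) ⟨ht, le_rfl⟩

/-- The deviation `z - S x` is compared with the zero function: its forcing `B z` is bounded by `‖B‖
(M ‖x‖ + ‖z - S x‖)`. This makes the perturbed operators bounded. -/
theorem exists_norm_le_of_mild_perturbed (T : ℝ) : ∃ C, ∀ (x : E) (z : ℝ → E), Continuous z →
    (∀ t, 0 ≤ t → z t = S.mild x (fun s => B (z s)) t) → ∀ t ∈ Icc 0 T, ‖z t‖ ≤ C * ‖x‖ := by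
  obtain ⟨M, hM1, hM⟩ := S.exists_norm_le T
  refine ⟨M * ‖B‖ * M * T * Real.exp (M * ‖B‖ * T) + M, fun x z hz ez t ht => ?_⟩
  have hT : 0 ≤ T := ht.1.trans ht.2
  have hzt (s : ℝ) (hs : s ∈ Icc 0 T) : ‖z s‖ ≤ ‖z s - S.opReal s x - 0‖ + M * ‖x‖ := by
    rw [sub_zero]
    calc ‖z s‖ = ‖(z s - S.opReal s x) + S.opReal s x‖ := by rw [sub_add_cancel]
      _ ≤ _ := (norm_add_le _ _).trans
        (add_le_add_right ((S.opReal s).le_of_opNorm_le (hM s hs.2) x) _)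
  have h1 := S.norm_sub_le_of_integral_eq (T := T) (M := M) (a := ‖B‖ * (M * ‖x‖)) (L := ‖B‖) hM
    (by positivity) (norm_nonneg _) (h := fun _ => 0) (g₁ := fun s => B (z s)) (g₂ := fun _ => 0)
    (z₁ := fun t => z t - S.opReal t x) (z₂ := fun _ => 0) (by fun_prop) continuous_const
    (Continuous.intervalIntegrable (by fun_prop) _ _) (continuous_const.intervalIntegrable _ _)
    (fun t ht => by rw [ez t ht.1, mild]; abel) (fun t _ => by simp)
    (fun s hs => by
      rw [sub_zero, add_comm, ← mul_add]
      exact (B.le_opNorm _).trans (mul_le_mul_of_nonneg_left (hzt s hs) (norm_nonneg _))) ht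
  refine (hzt t ht).trans ?_
  have h2 : Real.exp (M * ‖B‖ * t) ≤ Real.exp (M * ‖B‖ * T) := by
    gcongr
    exact ht.2
  calc _ ≤ M * (‖B‖ * (M * ‖x‖)) * T * Real.exp (M * ‖B‖ * T) + M * ‖x‖ := by
        refine add_le_add_left (h1.trans ?_) _
        exact mul_le_mul_of_nonneg_left h2 (by positivity)
    _ = _ := by ring

/-- A bounded perturbation of a strongly continuous semigroup. -/
theorem exists_perturbed : ∃ T : C0Semigroup E, ∀ (x : E) (t : ℝ), 0 ≤ t →
    T.opReal t x = S.mild x (fun s => B (T.opReal s x)) t := by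
  have hex (x : E) := S.exists_integral_eq (G := fun _ z => B z) (L := ‖B‖)
    (by simp only [Function.uncurry_def]; fun_prop) (norm_nonneg _)
    (fun s z w => by rw [← map_sub]; exact B.le_opNorm _) (h := fun t => S.opReal t x) (by fun_prop)
  choose z hz e using hex
  have hzi (x : E) (r a b : ℝ) :
      IntervalIntegrable (fun s => S.opReal (r - s) (B (z x s))) volume a b :=
    Continuous.intervalIntegrable (by have := hz x; fun_prop) _ _
  have hadd (x y : E) (t : ℝ) (ht : 0 ≤ t) : z (x + y) t = z x t + z y t := by
    refine S.eq_of_mild_perturbed B (x := x + y) (hz _) ((hz x).add (hz y)) (e _)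
      (fun t ht => ?_) ht
    simp only [mild, map_add, Pi.add_apply]
    rw [intervalIntegral.integral_add (hzi x t 0 t) (hzi y t 0 t), e x t ht, e y t ht]
    abel
  have hsmul (r : ℝ) (x : E) (t : ℝ) (ht : 0 ≤ t) : z (r • x) t = r • z x t := by
    refine S.eq_of_mild_perturbed B (x := r • x) (hz _) ((hz x).const_smul r) (e _)
      (fun t ht => ?_) ht
    simp only [mild, map_smul, Pi.smul_apply]
    rw [intervalIntegral.integral_smul, e x t ht, smul_add]
  have hbd (t : ℝ≥0) : ∃ C, ∀ x, ‖z x t‖ ≤ C * ‖x‖ := by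
    obtain ⟨C, hC⟩ := S.exists_norm_le_of_mild_perturbed B t
    exact ⟨C, fun x => hC x (z x) (hz x) (e x) t ⟨t.2, le_rfl⟩⟩
  choose C hC using hbd
  have hz0 (x : E) : z x 0 = x := by simp [e x 0 le_rfl]
  let T : C0Semigroup E :=
    { op := fun t => LinearMap.mkContinuous
        { toFun := fun x => z x t
          map_add' := fun x y => hadd x y t t.2
          map_smul' := fun r x => hsmul r x t t.2 } (C t) (hC t)
      op_zero := by ext x; exact hz0 x
      op_add := fun s t => by
        ext x
        change z x (s + t : ℝ≥0) = z (z x t) s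
        -- The semigroup law is uniqueness: the solution shifted by `t` solves the same equation
        -- from `z x t`.
        refine S.eq_of_mild_perturbed B (x := z x t) (z := fun r => z x (r + t))
          ((hz x).comp (by fun_prop)) (hz _) (fun r hr => ?_) (e _) s.2
        rw [add_comm r, e x (t + r) (by positivity)]
        have hg : LocallyIntegrable fun s => B (z x s) :=
          Continuous.locallyIntegrable (by have := hz x; fun_prop)
        exact (S.mild_add x hg t.2 hr).trans
          (congrArg (fun v => S.mild v (fun s => B (z x (s + t))) r) (e x t t.2).symm)
      tendsto_op := fun x => by
        have h1 : Continuous fun t : ℝ≥0 => z x t := (hz x).comp NNReal.continuous_coe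
        have h2 := (h1.tendsto 0).mono_left (nhdsWithin_le_nhds (s := Ioi 0))
        rw [NNReal.coe_zero, hz0] at h2
        exact h2 }
  have hT (x : E) (t : ℝ) (ht : 0 ≤ t) : T.opReal t x = z x t := by
    change z x (t.toNNReal) = z x t
    rw [Real.coe_toNNReal t ht]
  refine ⟨T, fun x t ht => ?_⟩
  rw [hT x t ht, e x t ht, mild]
  congr 1
  apply intervalIntegral.integral_congr
  intro s hs
  rw [uIcc_of_le ht] at hs
  dsimp only
  rw [hT x s hs.1]

variable {S B} in
-- The generator of the perturbed semigroup is `A + B`, with the same domain: the quotients differ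
-- by the average of `S (h - s) (B (T s x))`, which tends to `B x`.
theorem tendsto_perturbed_iff {T : C0Semigroup E} (hT : ∀ (x : E) (t : ℝ), 0 ≤ t →
    T.opReal t x = S.mild x (fun s => B (T.opReal s x)) t) (x z : E) :
    Tendsto (fun h : ℝ => h⁻¹ • (T.opReal h x - x)) (𝓝[>] 0) (𝓝 z) ↔
      Tendsto (fun h : ℝ => h⁻¹ • (S.opReal h x - x)) (𝓝[>] 0) (𝓝 (z - B x)) := by
  have hK : Continuous (Function.uncurry fun h s : ℝ => S.opReal (h - s) (B (T.opReal s x))) := by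
    simp only [Function.uncurry_def]; fun_prop
  have hl := tendsto_average hK
  simp only [sub_zero, opReal_zero] at hl
  have he : (fun h : ℝ => h⁻¹ • (T.opReal h x - x)) =ᶠ[𝓝[>] 0] fun h =>
      h⁻¹ • (S.opReal h x - x) +
        h⁻¹ • ∫ s in (0 : ℝ)..h, S.opReal (h - s) (B (T.opReal s x)) := by
    filter_upwards [self_mem_nhdsWithin] with h (hh : 0 < h)
    rw [hT x h hh.le, mild, ← smul_add]
    congr 1; abel
  rw [tendsto_congr' he]
  constructor
  · intro h
    simpa using h.sub hl
  · intro h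
    simpa using h.add hl

end C0Semigroup

end Perturbation

/-! ### The generator of the internal dynamics -/

section Internal

variable {H : Type*} [NormedAddCommGroup H] [InnerProductSpace ℝ H]

theorem exists_coe_projI (b x : H) : ∃ r : ℝ, (projI b x : H) = x - r • b := by
  have h : x - projI b x ∈ (ℝ ∙ b)ᗮᗮ :=
    Submodule.sub_starProjection_mem_orthogonal (K := InternalSpace b) x
  rw [Submodule.orthogonal_orthogonal, Submodule.mem_span_singleton] at h
  obtain ⟨r, hr⟩ := h
  exact ⟨r, by rw [hr]; abel⟩

@[simp] theorem projI_coe {b : H} (η : InternalSpace b) : projI b (η : H) = η :=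
  Submodule.orthogonalProjectionOnto_mem_subspace_eq_self η

@[simp] theorem projI_self (b : H) : projI b b = 0 := by
  obtain ⟨r, hr⟩ := exists_coe_projI b b
  have h1 : ⟪b, (projI b b : H)⟫ = 0 :=
    Submodule.mem_orthogonal_singleton_iff_inner_right.1 (projI b b).2
  have h2 : (projI b b : H) = (1 - r) • b := by rw [hr, sub_smul, one_smul]
  have h3 : (projI b b : H) = 0 := by
    rw [← inner_self_eq_zero (𝕜 := ℝ), congrArg (⟪·, (projI b b : H)⟫) h2, inner_smul_left, h1,
      mul_zero]
  exact_mod_cast h3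

/-- The inclusion of the internal space into the kernel of `⟪c, ·⟫` along `b`. -/
def embI (b c : H) : InternalSpace b →L[ℝ] H :=
  (InternalSpace b).subtypeL -
    ((⟪c, b⟫⁻¹ • (innerSL ℝ c)).comp (InternalSpace b).subtypeL).smulRight b

theorem embI_apply (b c : H) (η : InternalSpace b) :
    embI b c η = (η : H) - (⟪c, (η : H)⟫ / ⟪c, b⟫) • b := by
  simp [embI, div_eq_inv_mul]

@[simp] theorem projI_embI (b c : H) (η : InternalSpace b) : projI b (embI b c η) = η := by
  simp [embI_apply]

theorem stateOf_eq (b c : H) (y : ℝ) (η : InternalSpace b) :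
    stateOf b c y η = (y / ⟪c, b⟫) • b + embI b c η := by
  rw [stateOf, embI_apply, add_sub_assoc]

theorem embI_projI {b c : H} (hbc : ⟪c, b⟫ ≠ 0) (x : H) :
    embI b c (projI b x) = x - (⟪c, x⟫ / ⟪c, b⟫) • b := by
  obtain ⟨r, hr⟩ := exists_coe_projI b x
  rw [embI_apply, hr, inner_sub_right, inner_smul_right, sub_div, mul_div_assoc, div_self hbc,
    mul_one, sub_smul]
  abel

theorem inner_embI {b c : H} (hbc : ⟪c, b⟫ ≠ 0) (η : InternalSpace b) :
    ⟪c, embI b c η⟫ = 0 := by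
  rw [embI_apply, inner_sub_right, inner_smul_right, div_mul_cancel₀ _ hbc, sub_self]

theorem stateOf_projI {b c : H} (hbc : ⟪c, b⟫ ≠ 0) (x : H) :
    stateOf b c ⟪x, c⟫ (projI b x) = x := by
  rw [stateOf_eq, embI_projI hbc, real_inner_comm]
  abel

theorem norm_stateOf_sub_le (b c : H) (y y' : ℝ) (η η' : InternalSpace b) :
    ‖stateOf b c y η - stateOf b c y' η'‖ ≤
      ‖b‖ / |⟪c, b⟫| * |y - y'| + ‖embI b c‖ * ‖η - η'‖ := by
  have e : stateOf b c y η - stateOf b c y' η' =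
      ((y - y') / ⟪c, b⟫) • b + embI b c (η - η') := by
    rw [stateOf_eq, stateOf_eq, map_sub, sub_div, sub_smul]; abel
  rw [e]
  refine (norm_add_le _ _).trans (add_le_add (le_of_eq ?_) ((embI b c).le_opNorm _))
  rw [norm_smul, Real.norm_eq_abs, abs_div]
  ring

variable [CompleteSpace H] {A : H →ₗ.[ℝ] H} {b : A.domain} {c : A†.domain}

theorem inner_eq_of_mem_graph (hA : Dense (A.domain : Set H)) {x z : H} (h : (x, z) ∈ A.graph) :
    ⟪z, (c : H)⟫ = ⟪x, A† c⟫ := by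
  obtain ⟨y, rfl, rfl⟩ := (LinearPMap.mem_graph_iff A).1 h
  have := LinearPMap.adjoint_isFormalAdjoint hA c y
  rw [real_inner_comm, ← this, real_inner_comm]

/-- `Q` is `P^⊥ A` composed with the embedding onto `ker ⟪c, ·⟫`. Because `b ∈ D(A)`, correcting `η`
by a multiple of `b` does not affect membership in the domain. -/
theorem mem_graph_opQ_iff {η ζ : InternalSpace (b : H)} :
    (η, ζ) ∈ (opQ A b c).graph ↔
      ∃ z, (embI (b : H) c η, z) ∈ A.graph ∧ projI (b : H) z = ζ := by
  have key (x : A.domain) (hx : (x : H) = η) : ∃ h : embI (b : H) c η ∈ A.domain,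
      A ⟨_, h⟩ = A x - (⟪(c : H), (η : H)⟫ / ⟪(c : H), (b : H)⟫) • A b := by
    have e : embI (b : H) c η =
        ((x - (⟪(c : H), (η : H)⟫ / ⟪(c : H), (b : H)⟫) • b : A.domain) : H) := by
      rw [embI_apply, ← hx]; rfl
    refine ⟨e ▸ Subtype.coe_prop _, ?_⟩
    rw [← A.map_smul, ← A.map_sub]
    congr 1
    exact Subtype.ext e
  constructor
  · intro h
    obtain ⟨η', h1, h2⟩ := (LinearPMap.mem_graph_iff _).1 h
    dsimp only at h1 h2
    subst h1
    obtain ⟨hd, he⟩ := key ⟨((η' : InternalSpace (b : H)) : H), η'.2⟩ rfl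
    refine ⟨A ⟨_, hd⟩, A.mem_graph ⟨_, hd⟩, ?_⟩
    rw [he, map_sub, map_smul, ← h2]
    rfl
  · rintro ⟨z, hz, rfl⟩
    obtain ⟨x, hx, rfl⟩ := (LinearPMap.mem_graph_iff _).1 hz
    dsimp only at hx
    have hd : (η : H) ∈ A.domain := by
      have e : (η : H) = ((x + (⟪(c : H), (η : H)⟫ / ⟪(c : H), (b : H)⟫) • b : A.domain) : H) := by
        rw [Submodule.coe_add, hx, embI_apply]; simp
      exact e ▸ Subtype.coe_prop _
    obtain ⟨hd', he⟩ := key ⟨η, hd⟩ rfl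
    have hx' : x = ⟨_, hd'⟩ := Subtype.ext hx
    rw [hx', he, map_sub, map_smul]
    exact (LinearPMap.mem_graph_iff _).2 ⟨⟨η, hd⟩, rfl, rfl⟩

/-- The operator `Q` of the internal dynamics generates a strongly continuous semigroup. -/
theorem generates_opQ (hA : GeneratesC0Semigroup A) (hbc : ⟪(c : H), (b : H)⟫ ≠ 0) :
    GeneratesC0Semigroup (opQ A b c) := by
  obtain ⟨S, hS⟩ := hA
  have hd := hS.dense_domain
  set γ := ⟪(c : H), (b : H)⟫ with hγ
  -- `B` is chosen so that `⟪A x + B x, c⟫ = ⟪x, A* c⟫ - ⟪A* c, x⟫ = 0`, hence `⟪c, ·⟫` is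
  -- conserved; `hinv` proves this from the integrated equation, for every `x` and not only in the
  -- domain.
  let B : H →L[ℝ] H := (-(γ⁻¹ • innerSL ℝ (A† c))).smulRight (b : H)
  have hB (x : H) : B x = -(⟪A† c, x⟫ / γ) • (b : H) := by
    simp [B, div_eq_inv_mul]
  obtain ⟨T, hT⟩ := S.exists_perturbed B
  have hinv (t : ℝ≥0) (x : H) : ⟪(c : H), T.op t x⟫ = ⟪(c : H), x⟫ := by
    have hc : Continuous fun s => T.opReal s x := by fun_prop
    have hmem := hS.integral_mem_graph (Continuous.locallyIntegrable (by fun_prop)) hc (hT x)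
      t.coe_nonneg
    have h1 := inner_eq_of_mem_graph (c := c) hd hmem
    rw [ContinuousLinearMap.intervalIntegral_comp_comm B (hc.intervalIntegrable _ _), hB] at h1
    have h2 : T.opReal (t : ℝ) x = T.op t x := by rw [C0Semigroup.opReal, Real.toNNReal_coe]
    rw [h2, inner_sub_left, inner_sub_left, real_inner_smul_left, real_inner_comm (c : H) (b : H),
      ← hγ, neg_mul, div_mul_cancel₀ _ hbc, real_inner_comm (∫ s in (0 : ℝ)..t, T.opReal s x)] at h1
    rw [real_inner_comm, real_inner_comm x]
    linarith
  have hPT (t : ℝ≥0) (η : InternalSpace (b : H)) : embI (b : H) c (projI (b : H)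
      (T.op t (embI (b : H) c η))) = T.op t (embI (b : H) c η) := by
    rw [embI_projI hbc, hinv, inner_embI hbc, zero_div, zero_smul, sub_zero]
  refine ⟨T.conj (projI (b : H)) (embI (b : H) c) (projI_embI _ _) hPT, fun η ζ => ?_⟩
  rw [C0Semigroup.tendsto_conj_iff, C0Semigroup.tendsto_perturbed_iff hT, ← hS.mem_graph_iff,
    mem_graph_opQ_iff]
  constructor
  · rintro ⟨z, hz, rfl⟩
    -- For `z = A (embI η)`, `embI (P^⊥ z) = z - (⟪c, z⟫ / γ) b`, and `⟪c, z⟫ = ⟪A* c, embI η⟫`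
    -- makes the correction equal to `B (embI η)`.
    convert hz using 2
    rw [embI_projI hbc, hB, real_inner_comm, inner_eq_of_mem_graph (c := c) hd hz,
      real_inner_comm, hγ]
    simp
  · intro h
    refine ⟨_, h, ?_⟩
    rw [map_sub, hB]
    simp

/-- The variables `y = ⟪x, c⟫`, `η = P^⊥ x` satisfy the internal dynamics in integrated form. -/
theorem integrated_internal (hbc : ⟪(c : H), (b : H)⟫ ≠ 0) {x g : ℝ → H} (hx : Continuous x)
    (hg : LocallyIntegrable g) {x₀ : H} {t : ℝ}
    (h : (∫ s in (0 : ℝ)..t, x s, x t - x₀ - ∫ s in (0 : ℝ)..t, g s) ∈ A.graph) :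
    (∫ s in (0 : ℝ)..t, projI (b : H) (x s), projI (b : H) (x t) - projI (b : H) x₀ -
      ∫ s in (0 : ℝ)..t, (opR A b c ⟪x s, (c : H)⟫ + projI (b : H) (g s))) ∈ (opQ A b c).graph := by
  have hgi := intervalIntegrable_of_locallyIntegrable hg 0 t
  have hxi := hx.intervalIntegrable (μ := volume) 0 t
  set X := ∫ s in (0 : ℝ)..t, x s
  have hX : ∫ s in (0 : ℝ)..t, projI (b : H) (x s) = projI (b : H) X :=
    ContinuousLinearMap.intervalIntegral_comp_comm _ hxi
  have hgP : ∫ s in (0 : ℝ)..t, projI (b : H) (g s) = projI (b : H) (∫ s in (0 : ℝ)..t, g s) :=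
    ContinuousLinearMap.intervalIntegral_comp_comm _ hgi
  have hR : ∫ s in (0 : ℝ)..t, opR A b c ⟪x s, (c : H)⟫ = opR A b c ⟪X, (c : H)⟫ := by
    have h1 : ⟪X, (c : H)⟫ = ∫ s in (0 : ℝ)..t, ⟪x s, (c : H)⟫ := by
      have := ContinuousLinearMap.intervalIntegral_comp_comm (innerSL ℝ (c : H)) hxi
      simp only [innerSL_apply_apply] at this
      rw [real_inner_comm, ← this]
      congr 1; ext s; exact real_inner_comm _ _
    simp only [opR, h1]
    rw [intervalIntegral.integral_smul_const, intervalIntegral.integral_div]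
  have hRi : IntervalIntegrable (fun s => opR A b c ⟪x s, (c : H)⟫) volume 0 t :=
    Continuous.intervalIntegrable (by unfold opR; fun_prop) _ _
  have hPi : IntervalIntegrable (fun s => projI (b : H) (g s)) volume 0 t :=
    ⟨(projI (b : H)).integrable_comp hgi.1, (projI (b : H)).integrable_comp hgi.2⟩
  rw [hX, intervalIntegral.integral_add hRi hPi, hgP, hR, mem_graph_opQ_iff, embI_projI hbc]
  -- Subtracting this multiple of `(b, A b)` moves the first component into `ker ⟪c, ·⟫`; after
  -- projection, the subtracted image is exactly the integral of `R y`.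
  have hbg : ((⟪(c : H), X⟫ / ⟪(c : H), (b : H)⟫) • (b : H),
      (⟪(c : H), X⟫ / ⟪(c : H), (b : H)⟫) • A b) ∈ A.graph :=
    A.graph.smul_mem _ (A.mem_graph b)
  refine ⟨_, A.graph.sub_mem h hbg, ?_⟩
  dsimp only
  simp only [map_sub, map_smul, opR, real_inner_comm X]
  abel

end Internal

/-! ### Mild solutions in the sense of the variation-of-constants formula -/

section Bridge

theorem locallyIntegrable_smul_const {E : Type*} [NormedAddCommGroup E] [NormedSpace ℝ E]
    {v : ℝ → ℝ} (hv : LocallyIntegrable v) (e : E) : LocallyIntegrable fun s => v s • e := by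
  intro x
  obtain ⟨U, hU, h⟩ := hv x
  exact ⟨U, hU, h.smul_const e⟩

theorem C0Semigroup.op_add_integral_eq_mild {E : Type*} [NormedAddCommGroup E] [NormedSpace ℝ E]
    (S : C0Semigroup E) (z₀ : E) (g : ℝ≥0 → E) (t : ℝ≥0) :
    S.op t z₀ + ∫ s in (0 : ℝ)..t, S.op (t - s.toNNReal) (g s.toNNReal) =
      S.mild z₀ (fun s => g s.toNNReal) t := by
  rw [mild, opReal, Real.toNNReal_coe]
  congr 1
  apply intervalIntegral.integral_congr
  intro s hs
  rw [uIcc_of_le t.coe_nonneg] at hs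
  dsimp only
  rw [opReal, NNReal.sub_def, Real.coe_toNNReal s hs.1]

/-- The existential over semigroups in the definition is harmless, since the generator determines
the semigroup. -/
theorem isMildSolution_iff {E : Type*} [NormedAddCommGroup E] [NormedSpace ℝ E] [CompleteSpace E]
    {S : C0Semigroup E} {A : E →ₗ.[ℝ] E} (hS : S.IsGenerator A) {z₀ : E} {g : ℝ≥0 → E} {ω : ℝ≥0∞}
    {z : ℝ≥0 → E} : IsMildSolution A z₀ g ω z ↔ ContinuousOn z {t : ℝ≥0 | (t : ℝ≥0∞) < ω} ∧
      ∀ t : ℝ≥0, (t : ℝ≥0∞) < ω → z t = S.mild z₀ (fun s => g s.toNNReal) t := by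
  constructor
  · rintro ⟨S', hS', hc, h⟩
    have hSS : S'.op = S.op := by
      ext t x
      have := hS.opReal_eq hS' t.coe_nonneg x
      rwa [C0Semigroup.opReal, C0Semigroup.opReal, Real.toNNReal_coe] at this
    refine ⟨hc, fun t ht => ?_⟩
    rw [h t ht, hSS, S.op_add_integral_eq_mild]
  · rintro ⟨hc, h⟩
    exact ⟨S, hS, hc, fun t ht => by rw [h t ht, S.op_add_integral_eq_mild]⟩

theorem isMildSolution_top_iff {E : Type*} [NormedAddCommGroup E] [NormedSpace ℝ E]
    [CompleteSpace E] {S : C0Semigroup E} {A : E →ₗ.[ℝ] E} (hS : S.IsGenerator A) {z₀ : E}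
    {g z : ℝ≥0 → E} : IsMildSolution A z₀ g ∞ z ↔ Continuous z ∧
      ∀ t : ℝ≥0, z t = S.mild z₀ (fun s => g s.toNNReal) t := by
  rw [isMildSolution_iff hS]
  simp [ENNReal.coe_lt_top, continuousOn_univ]

theorem MemLinftyLoc.locallyIntegrable {v : ℝ≥0 → ℝ} (hv : MemLinftyLoc v) :
    LocallyIntegrable fun s : ℝ => v s.toNNReal := by
  rw [locallyIntegrable_iff]
  intro k hk
  -- At negative times `s.toNNReal = 0`, so the extended signal is the constant `v 0` there.
  obtain ⟨R, hR⟩ := hk.isBounded.subset_closedBall 0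
  rw [Real.closedBall_eq_Icc, zero_sub, zero_add] at hR
  have h1 : IntegrableOn (fun s : ℝ => v s.toNNReal) (Iic 0 ∩ Icc (-R) R) := by
    have : IntegrableOn (fun _ : ℝ => v 0) (Iic 0 ∩ Icc (-R) R) :=
      integrableOn_const (hs := ((measure_mono inter_subset_right).trans_lt
        (isCompact_Icc.measure_lt_top)).ne)
    refine this.congr_fun (fun s hs => ?_) (measurableSet_Iic.inter measurableSet_Icc)
    dsimp only
    rw [Real.toNNReal_of_nonpos hs.1]
  have h2 : IntegrableOn (fun s : ℝ => v s.toNNReal) (Icc 0 (R.toNNReal : ℝ)) := by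
    have := hv R.toNNReal
    exact this.integrable le_top
  refine (h1.union h2).mono_set fun s hs => ?_
  rcases le_total s 0 with h | h
  · exact Or.inl ⟨h, hR hs⟩
  · exact Or.inr ⟨h, (hR hs).2.trans (Real.le_coe_toNNReal R)⟩

theorem MemLinfty.memLinftyLoc {v : ℝ≥0 → ℝ} (hv : MemLinfty v) : MemLinftyLoc v := fun _ =>
  hv.mono_measure (Measure.restrict_mono Icc_subset_Ici_self le_rfl)

theorem memLinftyLoc_of_continuous {v : ℝ≥0 → ℝ} (hv : Continuous v) : MemLinftyLoc v := by
  intro t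
  have hc : Continuous fun s : ℝ => v s.toNNReal := hv.comp continuous_real_toNNReal
  obtain ⟨C, hC⟩ := isCompact_Icc.exists_bound_of_continuousOn (s := Icc 0 (t : ℝ)) hc.continuousOn
  refine MemLp.of_bound hc.aestronglyMeasurable C ?_
  filter_upwards [ae_restrict_mem measurableSet_Icc] with s hs using hC s hs

end Bridge

/-! ### The internal dynamics -/

section InternalDynamics

variable {H : Type*} [NormedAddCommGroup H] [InnerProductSpace ℝ H]

theorem exists_norm_stateOf_sub_le (b c : H) : ∃ K : ℝ, 0 ≤ K ∧ ∀ y y' (η η' : InternalSpace b),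
    ‖stateOf b c y η - stateOf b c y' η'‖ ≤ K * (|y - y'| + ‖η - η'‖) := by
  refine ⟨‖b‖ / |⟪c, b⟫| + ‖embI b c‖, by positivity, fun y y' η η' => ?_⟩
  refine (norm_stateOf_sub_le b c y y' η η').trans ?_
  have h1 : 0 ≤ ‖b‖ / |⟪c, b⟫| * ‖η - η'‖ := by positivity
  have h2 : 0 ≤ ‖embI b c‖ * |y - y'| := by positivity
  linarith

theorem exists_norm_fTilde_sub_le {f : H → H}
    (hf : ∃ L : ℝ≥0, LipschitzWith L f) (b c : H) :
    ∃ K : ℝ, 0 ≤ K ∧ ∀ y y' (η η' : InternalSpace b),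
      ‖fTilde f b c y η - fTilde f b c y' η'‖ ≤ K * (|y - y'| + ‖η - η'‖) := by
  obtain ⟨L, hL⟩ := hf
  obtain ⟨K, hK0, hK⟩ := exists_norm_stateOf_sub_le b c
  refine ⟨L * K, by positivity, fun y y' η η' => ?_⟩
  rw [mul_assoc]
  exact (hL.norm_sub_le _ _).trans (mul_le_mul_of_nonneg_left (hK _ _ _ _) L.2)

variable [CompleteSpace H] {A : H →ₗ.[ℝ] H} {f : H → H} {b : A.domain} {c : A†.domain}

theorem exists_norm_forcing_sub_le (hf : ∃ L : ℝ≥0, LipschitzWith L f) :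
    ∃ K : ℝ, 0 ≤ K ∧ ∀ y y' (η η' : InternalSpace (b : H)),
      ‖(opR A b c y + projI (b : H) (fTilde f (b : H) (c : H) y η)) -
        (opR A b c y' + projI (b : H) (fTilde f (b : H) (c : H) y' η'))‖ ≤
          K * (|y - y'| + ‖η - η'‖) := by
  obtain ⟨K, hK0, hK⟩ := exists_norm_fTilde_sub_le hf (b : H) (c : H)
  refine ⟨‖projI (b : H) (A b)‖ / |⟪(c : H), (b : H)⟫| + ‖projI (b : H)‖ * K, by positivity,
    fun y y' η η' => ?_⟩
  have e : (opR A b c y + projI (b : H) (fTilde f (b : H) (c : H) y η)) -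
        (opR A b c y' + projI (b : H) (fTilde f (b : H) (c : H) y' η')) =
      ((y - y') / ⟪(c : H), (b : H)⟫) • projI (b : H) (A b) +
        projI (b : H) (fTilde f (b : H) (c : H) y η - fTilde f (b : H) (c : H) y' η') := by
    rw [opR, opR, map_sub, sub_div, sub_smul]; abel
  rw [e, add_mul]
  refine (norm_add_le _ _).trans (add_le_add ?_ ?_)
  · rw [norm_smul, Real.norm_eq_abs, abs_div, div_mul_eq_mul_div, div_mul_eq_mul_div, mul_comm]
    gcongr
    linarith [norm_nonneg (η - η')]
  · rw [mul_assoc]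
    exact ((projI (b : H)).le_opNorm _).trans
      (mul_le_mul_of_nonneg_left (hK _ _ _ _) (norm_nonneg _))

/-- The linear part of `T` is the weak form of `⟪A x, c⟫` in the new coordinates. -/
theorem inner_stateOf_adjoint (y : ℝ) (η : InternalSpace (b : H)) :
    ⟪stateOf (b : H) (c : H) y η, A† c⟫ = opP0 A b c y + opS A b c η := by
  simp only [stateOf, opP0, opS, obliqueProj, inner_add_left, inner_sub_left, inner_sub_right,
    real_inner_smul_left, real_inner_smul_right, real_inner_comm (b : H) (A† c),
    real_inner_comm (η : H) (c : H)]
  ring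

theorem exists_abs_output_sub_le (hf : ∃ L : ℝ≥0, LipschitzWith L f) :
    ∃ K : ℝ, 0 ≤ K ∧ ∀ y y' (η η' : InternalSpace (b : H)),
      |(opP0 A b c y + opS A b c η + ⟪fTilde f (b : H) (c : H) y η, (c : H)⟫) -
        (opP0 A b c y' + opS A b c η' + ⟪fTilde f (b : H) (c : H) y' η', (c : H)⟫)| ≤
          K * (|y - y'| + ‖η - η'‖) := by
  obtain ⟨K, hK0, hK⟩ := exists_norm_fTilde_sub_le hf (b : H) (c : H)
  obtain ⟨K', hK'0, hK'⟩ := exists_norm_stateOf_sub_le (b : H) (c : H)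
  refine ⟨K' * ‖A† c‖ + K * ‖(c : H)‖, by positivity, fun y y' η η' => ?_⟩
  rw [← inner_stateOf_adjoint, ← inner_stateOf_adjoint, add_sub_add_comm, ← inner_sub_left,
    ← inner_sub_left]
  refine (abs_add_le _ _).trans ?_
  rw [add_mul, mul_right_comm K', mul_right_comm K]
  refine add_le_add ((abs_real_inner_le_norm _ _).trans ?_)
    ((abs_real_inner_le_norm _ _).trans ?_)
  · exact mul_le_mul_of_nonneg_right (hK' _ _ _ _) (norm_nonneg _)
  · exact mul_le_mul_of_nonneg_right (hK _ _ _ _) (norm_nonneg _)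

theorem continuous_forcing (hf : ∃ L : ℝ≥0, LipschitzWith L f) {X : Type*} [TopologicalSpace X]
    {y : X → ℝ} {η : X → InternalSpace (b : H)} (hy : Continuous y) (hη : Continuous η) :
    Continuous fun s => opR A b c (y s) + projI (b : H) (fTilde f (b : H) (c : H) (y s) (η s)) := by
  obtain ⟨L, hL⟩ := hf
  have hfc := hL.continuous
  have h1 : Continuous fun s => stateOf (b : H) (c : H) (y s) (η s) := by
    simp only [stateOf_eq]
    fun_prop
  unfold opR fTilde
  fun_prop

theorem continuous_output (hf : ∃ L : ℝ≥0, LipschitzWith L f) {X : Type*} [TopologicalSpace X]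
    {y : X → ℝ} {η : X → InternalSpace (b : H)} (hy : Continuous y) (hη : Continuous η) :
    Continuous fun s => opP0 A b c (y s) + opS A b c (η s) +
      ⟪fTilde f (b : H) (c : H) (y s) (η s), (c : H)⟫ := by
  obtain ⟨L, hL⟩ := hf
  have hfc := hL.continuous
  have h1 : Continuous fun s => stateOf (b : H) (c : H) (y s) (η s) := by
    simp only [stateOf_eq]
    fun_prop
  simp only [← inner_stateOf_adjoint]
  unfold fTilde
  fun_prop

/-- Continuous dependence of the internal state on the driving signal. -/
theorem exists_norm_internal_sub_le (hA : GeneratesC0Semigroup A)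
    (hf : ∃ L : ℝ≥0, LipschitzWith L f) (hbc : ⟪(c : H), (b : H)⟫ ≠ 0) (T : ℝ≥0) :
    ∃ C : ℝ, 0 ≤ C ∧ ∀ (η₀ : InternalSpace (b : H)) (y y' : C(ℝ≥0, ℝ))
      (η η' : C(ℝ≥0, InternalSpace (b : H))), IsInternalSolution A f b c η₀ y η →
      IsInternalSolution A f b c η₀ y' η' → ∀ a : ℝ, 0 ≤ a → ∀ t ≤ T,
      (∀ s ≤ t, |y s - y' s| ≤ a) → ‖η t - η' t‖ ≤ C * a := by
  obtain ⟨V, hV⟩ := generates_opQ (c := c) hA hbc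
  obtain ⟨M, hM1, hM⟩ := V.exists_norm_le T
  obtain ⟨K, hK0, hK⟩ := exists_norm_forcing_sub_le (A := A) (b := b) (c := c) hf
  refine ⟨M * K * T * Real.exp (M * K * T), by positivity,
    fun η₀ y y' η η' hη hη' a ha t ht hy => ?_⟩
  obtain ⟨-, e⟩ := (isMildSolution_top_iff hV).1 hη
  obtain ⟨-, e'⟩ := (isMildSolution_top_iff hV).1 hη'
  have hG (y : C(ℝ≥0, ℝ)) (η : C(ℝ≥0, InternalSpace (b : H))) : Continuous fun s : ℝ =>
      opR A b c (y s.toNNReal) +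
        projI (b : H) (fTilde f (b : H) (c : H) (y s.toNNReal) (η s.toNNReal)) :=
    continuous_forcing hf (y.continuous.comp continuous_real_toNNReal)
      (η.continuous.comp continuous_real_toNNReal)
  have htT : (t : ℝ) ≤ T := ht
  have := V.norm_sub_le_of_integral_eq (T := t) (M := M) (a := K * a) (L := K)
    (h := fun t => V.opReal t η₀) (z₁ := fun s => η s.toNNReal) (z₂ := fun s => η' s.toNNReal)
    (fun s hs => hM s (hs.trans htT)) (by positivity) hK0
    (η.continuous.comp continuous_real_toNNReal) (η'.continuous.comp continuous_real_toNNReal)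
    ((hG y η).intervalIntegrable _ _) ((hG y' η').intervalIntegrable _ _)
    (fun s hs => by
      have := e s.toNNReal
      rwa [Real.coe_toNNReal s hs.1] at this)
    (fun s hs => by
      have := e' s.toNNReal
      rwa [Real.coe_toNNReal s hs.1] at this)
    (fun s hs => by
      refine (hK _ _ _ _).trans ?_
      rw [mul_add]
      gcongr
      exact hy _ (Real.toNNReal_le_iff_le_coe.2 hs.2)) (t := t) ⟨t.coe_nonneg, le_rfl⟩
  simp only [Real.toNNReal_coe] at this
  refine this.trans ?_
  calc M * (K * a) * t * Real.exp (M * K * t) ≤ M * (K * a) * T * Real.exp (M * K * T) := by gcongr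
    _ = _ := by ring

theorem internalSolution_unique (hA : GeneratesC0Semigroup A)
    (hf : ∃ L : ℝ≥0, LipschitzWith L f) (hbc : ⟪(c : H), (b : H)⟫ ≠ 0)
    {η₀ : InternalSpace (b : H)} {y : C(ℝ≥0, ℝ)} {η η' : C(ℝ≥0, InternalSpace (b : H))}
    (hη : IsInternalSolution A f b c η₀ y η) (hη' : IsInternalSolution A f b c η₀ y η') :
    η = η' := by
  ext1 t
  obtain ⟨C, -, hC⟩ := exists_norm_internal_sub_le hA hf hbc t
  have := hC η₀ y y η η' hη hη' 0 le_rfl t le_rfl (fun s _ => by simp)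
  rw [mul_zero] at this
  exact sub_eq_zero.1 (norm_le_zero_iff.1 this)

theorem exists_internalSolution (hA : GeneratesC0Semigroup A)
    (hf : ∃ L : ℝ≥0, LipschitzWith L f) (hbc : ⟪(c : H), (b : H)⟫ ≠ 0)
    (η₀ : InternalSpace (b : H)) (y : C(ℝ≥0, ℝ)) : ∃ η, IsInternalSolution A f b c η₀ y η := by
  obtain ⟨V, hV⟩ := generates_opQ (c := c) hA hbc
  obtain ⟨K, hK0, hK⟩ := exists_norm_forcing_sub_le (A := A) (b := b) (c := c) hf
  obtain ⟨z, hz, e⟩ := V.exists_integral_eq (G := fun s η => opR A b c (y s.toNNReal) +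
    projI (b : H) (fTilde f (b : H) (c : H) (y s.toNNReal) η)) (L := K)
    (continuous_forcing hf (y.continuous.comp (continuous_real_toNNReal.comp continuous_fst))
      continuous_snd) hK0 (fun s η η' => by simpa using hK (y s.toNNReal) (y s.toNNReal) η η')
    (h := fun t => V.opReal t η₀) (by fun_prop)
  refine ⟨⟨fun t => z t, hz.comp NNReal.continuous_coe⟩,
    (isMildSolution_top_iff hV).2 ⟨hz.comp NNReal.continuous_coe, fun t => ?_⟩⟩
  change z t = _
  rw [e t t.coe_nonneg, C0Semigroup.mild]
  congr 1
  apply intervalIntegral.integral_congr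
  intro s hs
  rw [uIcc_of_le t.coe_nonneg] at hs
  simp only [ContinuousMap.coe_mk, Real.coe_toNNReal s hs.1]

theorem internalState_spec (hA : GeneratesC0Semigroup A)
    (hf : ∃ L : ℝ≥0, LipschitzWith L f) (hbc : ⟪(c : H), (b : H)⟫ ≠ 0)
    (η₀ : InternalSpace (b : H)) (y : C(ℝ≥0, ℝ)) :
    IsInternalSolution A f b c η₀ y (internalState A f b c η₀ y) :=
  Classical.epsilon_spec (exists_internalSolution hA hf hbc η₀ y)

/-- Byrnes–Isidori form of the system. -/
theorem byrnesIsidori_form (hA : GeneratesC0Semigroup A)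
    (hf : ∃ L : ℝ≥0, LipschitzWith L f) (hbc : ⟪(c : H), (b : H)⟫ ≠ 0) {v : ℝ≥0 → ℝ}
    (hv : MemLinftyLoc v) {x₀ : H} {x : C(ℝ≥0, H)} {y : C(ℝ≥0, ℝ)}
    (hx : IsMildSolution A x₀ (fun s => f (x s) + v s • (b : H)) ∞ x)
    (hy : ∀ t, y t = ⟪x t, (c : H)⟫) :
    (∀ t, projI (b : H) (x t) = internalState A f b c (projI (b : H) x₀) y t) ∧
      ∀ t : ℝ≥0, y t = ⟪x₀, (c : H)⟫ + ∫ s in (0 : ℝ)..t,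
        (outputOperator A f b c (projI (b : H) x₀) y s.toNNReal +
          ⟪(b : H), (c : H)⟫ * v s.toNNReal) := by
  obtain ⟨S, hS⟩ := hA
  have hA : GeneratesC0Semigroup A := ⟨S, hS⟩
  obtain ⟨V, hV⟩ := generates_opQ (c := c) hA hbc
  obtain ⟨L, hL⟩ := hf
  have hf : ∃ L : ℝ≥0, LipschitzWith L f := ⟨L, hL⟩
  obtain ⟨-, e⟩ := (isMildSolution_top_iff hS).1 hx
  have hX : Continuous fun s : ℝ => x s.toNNReal := x.continuous.comp continuous_real_toNNReal
  have hY : Continuous fun s : ℝ => y s.toNNReal := y.continuous.comp continuous_real_toNNReal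
  have hfX : Continuous fun s : ℝ => f (x s.toNNReal) := hL.continuous.comp hX
  have hvl := hv.locallyIntegrable
  have hg : LocallyIntegrable fun s : ℝ => f (x s.toNNReal) + v s.toNNReal • (b : H) :=
    hfX.locallyIntegrable.add
      (locallyIntegrable_smul_const hvl (b : H))
  have hmem (t : ℝ) (ht : 0 ≤ t) := hS.integral_mem_graph (x := x₀) hg hX (fun t ht => by
    have := e t.toNNReal
    rwa [Real.coe_toNNReal t ht] at this) ht
  have hproj (t : ℝ≥0) : projI (b : H) (x t) = internalState A f b c (projI (b : H) x₀) y t := by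
    have hη : IsInternalSolution A f b c (projI (b : H) x₀) y
        ⟨fun t => projI (b : H) (x t), by fun_prop⟩ := by
      refine (isMildSolution_top_iff hV).2 ⟨ContinuousMap.continuous _, fun t => ?_⟩
      have hF : Continuous fun s : ℝ => opR A b c (y s.toNNReal) + projI (b : H)
          (fTilde f (b : H) (c : H) (y s.toNNReal) (projI (b : H) (x s.toNNReal))) :=
        continuous_forcing hf hY (by fun_prop)
      -- `P^⊥ b = 0` removes the input `v`, so the internal forcing is continuous although `v` is
      -- only in `L^∞_loc`.
      have hcg (s : ℝ) : opR A b c ⟪x s.toNNReal, (c : H)⟫ +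
          projI (b : H) (f (x s.toNNReal) + v s.toNNReal • (b : H)) =
          opR A b c (y s.toNNReal) + projI (b : H) (fTilde f (b : H) (c : H) (y s.toNNReal)
            (projI (b : H) (x s.toNNReal))) := by
        rw [fTilde, hy, stateOf_projI hbc, map_add, map_smul, projI_self, smul_zero, add_zero]
      have := hV.eq_mild (x := projI (b : H) x₀) (z := fun s : ℝ => projI (b : H) (x s.toNNReal))
        hF.locallyIntegrable (by fun_prop) (fun t ht => by
          simpa only [hcg] using integrated_internal (c := c) hbc hX hg (hmem t ht)) t.coe_nonneg
      rwa [Real.toNNReal_coe] at this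
    rw [← internalSolution_unique hA hf hbc hη (internalState_spec hA hf hbc _ y)]
    rfl
  refine ⟨hproj, fun t => ?_⟩
  have hgi := intervalIntegrable_of_locallyIntegrable hg 0 t
  -- Pairing the integrated equation with `c` moves `A` onto `c` and gives the output equation.
  have h1 := inner_eq_of_mem_graph (c := c) hS.dense_domain (hmem t t.coe_nonneg)
  rw [Real.toNNReal_coe, inner_sub_left, inner_sub_left, ← hy,
    real_inner_comm (c : H) (∫ _ in _.._, _),
    real_inner_comm (A† c)] at h1
  have h2 := ContinuousLinearMap.intervalIntegral_comp_comm (innerSL ℝ (c : H)) hgi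
  have h3 := ContinuousLinearMap.intervalIntegral_comp_comm (innerSL ℝ (A† c))
    (hX.intervalIntegrable (μ := volume) 0 t)
  simp only [innerSL_apply_apply] at h2 h3
  rw [← h2, ← h3] at h1
  have hi3 : IntervalIntegrable (fun s : ℝ => ⟪A† c, x s.toNNReal⟫) volume 0 t :=
    Continuous.intervalIntegrable (by fun_prop) _ _
  have hi2 : IntervalIntegrable (fun s : ℝ => ⟪(c : H), f (x s.toNNReal) + v s.toNNReal • (b : H)⟫)
      volume 0 t :=
    ⟨(innerSL ℝ (c : H)).integrable_comp hgi.1, (innerSL ℝ (c : H)).integrable_comp hgi.2⟩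
  have h4 : y t = ⟪x₀, (c : H)⟫ + ((∫ s in (0 : ℝ)..t, ⟪A† c, x s.toNNReal⟫) +
      ∫ s in (0 : ℝ)..t, ⟪(c : H), f (x s.toNNReal) + v s.toNNReal • (b : H)⟫) := by linarith
  rw [h4, ← intervalIntegral.integral_add hi3 hi2]
  congr 2
  ext s
  have h5 : stateOf (b : H) (c : H) (y s.toNNReal)
      (internalState A f b c (projI (b : H) x₀) y s.toNNReal) = x s.toNNReal := by
    rw [← hproj, hy, stateOf_projI hbc]
  rw [outputOperator, ← inner_stateOf_adjoint, fTilde, h5, inner_add_right, real_inner_smul_right,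
    real_inner_comm (A† c), real_inner_comm (c : H), real_inner_comm (c : H) (b : H)]
  ring

/-- The operator `T` is causal, bounded-input bounded-output stable and locally Lipschitz. -/
theorem isAdmissibleOperator_outputOperator (hA : GeneratesC0Semigroup A)
    (hf : ∃ L : ℝ≥0, LipschitzWith L f) (hbc : ⟪(c : H), (b : H)⟫ ≠ 0)
    (hB : IsBISBOStable A f b c) (η₀ : InternalSpace (b : H)) :
    IsAdmissibleOperator (outputOperator A f b c η₀) := by
  obtain ⟨K, hK0, hK⟩ := exists_abs_output_sub_le (A := A) (b := b) (c := c) hf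
  have hspec := internalState_spec hA hf hbc η₀
  refine ⟨fun y => ?_, fun k₁ hk₁ => ?_, fun t y y' hy s hs => ?_, fun t y => ?_⟩
  · exact memLinftyLoc_of_continuous (continuous_output hf y.continuous
      (internalState A f b c η₀ y).continuous)
  -- The `+ 1` keeps the radius positive when `η₀ = 0`. The output is then compared with its value
  -- `F0` at `(0, 0)`.
  · obtain ⟨C, hC0, hC⟩ := hB k₁ (‖η₀‖ + 1) hk₁ (by positivity)
    set F0 : ℝ := opP0 A b c 0 + opS A b c 0 + ⟪fTilde f (b : H) (c : H) 0 0, (c : H)⟫ with hF0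
    refine ⟨K * (k₁ + C) + |F0| + 1, by positivity, fun y hy t => ?_⟩
    have h1 := hC y η₀ _ (hspec y) hy (by linarith) t
    have h2 := hK (y t) 0 (internalState A f b c η₀ y t) 0
    rw [sub_zero, sub_zero, ← hF0] at h2
    have h3 : |outputOperator A f b c η₀ y t| ≤ |outputOperator A f b c η₀ y t - F0| + |F0| := by
      simpa using abs_add_le (outputOperator A f b c η₀ y t - F0) F0
    have h4 : K * (|y t| + ‖internalState A f b c η₀ y t‖) ≤ K * (k₁ + C) := by
      gcongr
      exact hy t
    change |outputOperator A f b c η₀ y t - F0| ≤ _ at h2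
    linarith
  · obtain ⟨C, hC0, hC⟩ := exists_norm_internal_sub_le hA hf hbc s
    have h1 := hC η₀ y y' _ _ (hspec y) (hspec y') 0 le_rfl s le_rfl
      (fun r hr => by rw [hy r (hr.trans_lt hs)]; simp)
    rw [mul_zero] at h1
    rw [outputOperator, outputOperator, hy s hs, sub_eq_zero.1 (norm_le_zero_iff.1 h1)]
  -- All data are globally Lipschitz, so `τ = δ = 1` will do. The inputs agree on `[0, t]`, so their
  -- distance on `[0, s]` is at most the supremum `a` over `[t, t + 1]`.
  · obtain ⟨C, hC0, hC⟩ := exists_norm_internal_sub_le hA hf hbc (t + 1)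
    refine ⟨1, 1, K * (1 + C) + 1, one_pos, one_pos, by positivity,
      fun y₁ y₂ h₁ h₂ _ _ s hs => ?_⟩
    set a : ℝ := ⨆ r : Icc t (t + 1), |y₁ r - y₂ r| with ha
    have hbdd : BddAbove (range fun r : Icc t (t + 1) => |y₁ r - y₂ r|) :=
      (isCompact_range (by fun_prop)).bddAbove
    have ha' (r : ℝ≥0) (hr : r ∈ Icc t (t + 1)) : |y₁ r - y₂ r| ≤ a := le_ciSup hbdd ⟨r, hr⟩
    have ha0 : 0 ≤ a := (abs_nonneg _).trans (ha' s hs)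
    have hle (r : ℝ≥0) (hr : r ≤ s) : |y₁ r - y₂ r| ≤ a := by
      rcases le_total r t with h | h
      · have e₁ := h₁ ⟨r, h⟩
        have e₂ := h₂ ⟨r, h⟩
        dsimp only at e₁ e₂
        rw [e₁, e₂]
        simpa using ha0
      · exact ha' r ⟨h, hr.trans hs.2⟩
    have h1 := hC η₀ y₁ y₂ _ _ (hspec y₁) (hspec y₂) a ha0 s hs.2 hle
    refine (hK _ _ _ _).trans ?_
    have h2 : K * (|y₁ s - y₂ s| + ‖internalState A f b c η₀ y₁ s -
        internalState A f b c η₀ y₂ s‖) ≤ K * (a + C * a) := by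
      gcongr
      exact ha' s hs
    linarith

end InternalDynamics

/-! ### Signals -/

section Signals

theorem MemLinfty.exists_ae_bound {g : ℝ≥0 → ℝ} (hg : MemLinfty g) :
    ∃ C : ℝ, 0 ≤ C ∧ ∀ᵐ s : ℝ, 0 ≤ s → |g s.toNNReal| ≤ C := by
  refine ⟨_, ENNReal.toReal_nonneg (a := eLpNormEssSup (fun s : ℝ => g s.toNNReal)
    (volume.restrict (Ici 0))), ?_⟩
  have h1 := hg.eLpNorm_lt_top
  rw [eLpNorm_exponent_top] at h1
  have h2 := enorm_ae_le_eLpNormEssSup (fun s : ℝ => g s.toNNReal) (volume.restrict (Ici 0))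
  rw [ae_restrict_iff' measurableSet_Ici] at h2
  filter_upwards [h2] with s hs h0
  have := ENNReal.toReal_mono h1.ne (hs h0)
  rwa [toReal_enorm] at this

theorem MemW1infty.exists_lipschitz {g : ℝ≥0 → ℝ} (hg : MemW1infty g) :
    ∃ K : ℝ, 0 ≤ K ∧ ∀ s t : ℝ≥0, s ≤ t → |g t - g s| ≤ K * (t - s) := by
  obtain ⟨-, g', hg', h⟩ := hg
  obtain ⟨K, hK0, hK⟩ := hg'.exists_ae_bound
  refine ⟨K, hK0, fun s t hst => ?_⟩
  have hi := fun a b => intervalIntegrable_of_locallyIntegrable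
    hg'.memLinftyLoc.locallyIntegrable a b
  have hst' : (s : ℝ) ≤ t := hst
  rw [h t, h s, add_sub_add_left_eq_sub, intervalIntegral.integral_interval_sub_left (hi _ _)
    (hi _ _)]
  have := intervalIntegral.norm_integral_le_of_norm_le (f := fun s : ℝ => g' s.toNNReal)
    (g := fun _ => K) hst'
    (by filter_upwards [hK] with r hr hrs using hr (s.coe_nonneg.trans hrs.1.le))
    (continuous_const.intervalIntegrable _ _)
  rw [intervalIntegral.integral_const, smul_eq_mul, mul_comm] at this
  exact this

theorem MemW1infty.continuous {g : ℝ≥0 → ℝ} (hg : MemW1infty g) : Continuous g := by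
  obtain ⟨K, hK0, hK⟩ := hg.exists_lipschitz
  have : LipschitzWith K.toNNReal g := by
    refine LipschitzWith.of_dist_le_mul fun s t => ?_
    rw [Real.coe_toNNReal K hK0, Real.dist_eq, NNReal.dist_eq]
    rcases le_total s t with h | h
    · have h' : (s : ℝ) ≤ t := h
      rw [abs_sub_comm, abs_sub_comm (s : ℝ), abs_of_nonneg (sub_nonneg.2 h')]
      exact hK s t h
    · have h' : (t : ℝ) ≤ s := h
      rw [abs_of_nonneg (sub_nonneg.2 h')]
      exact hK t s h
  exact this.continuous

theorem MemW1infty.exists_bound {g : ℝ≥0 → ℝ} (hg : MemW1infty g) :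
    ∃ C : ℝ, 0 < C ∧ ∀ t, |g t| ≤ C := by
  obtain ⟨C, hC0, hC⟩ := hg.1.exists_ae_bound
  have hc : Continuous fun s : ℝ => g s.toNNReal := hg.continuous.comp continuous_real_toNNReal
  -- For continuous functions an equality valid almost everywhere on `[0, ∞)` holds everywhere, so
  -- the essential bound is a genuine one.
  have h1 : EqOn (fun s : ℝ => max |g s.toNNReal| C) (fun _ => C) (Ici 0) := by
    refine Measure.eqOn_of_ae_eq (μ := volume) ?_ (hc.abs.max continuous_const).continuousOn
      continuousOn_const ?_
    · rw [EventuallyEq, ae_restrict_iff' measurableSet_Ici]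
      filter_upwards [hC] with s hs h0 using max_eq_right (hs h0)
    · rw [interior_Ici, closure_Ioi]
  refine ⟨C + 1, by positivity, fun t => ?_⟩
  have := h1 t.coe_nonneg
  dsimp only at this
  rw [Real.toNNReal_coe] at this
  linarith [le_max_left |g t| C]

/-- The lower limit controls a tail `[T, ∞)`; on `[0, T]` the continuous positive `φ` attains its
minimum. -/
theorem IsFunnelFunction.exists_lower_bound {φ : ℝ≥0 → ℝ} (hφ : IsFunnelFunction φ) :
    ∃ m : ℝ, 0 < m ∧ ∀ t, m ≤ φ t := by
  obtain ⟨l, hl0, hl⟩ := exists_between hφ.liminf_pos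
  obtain ⟨C, -, hC⟩ := hφ.memW1infty.exists_bound
  have hb : IsBoundedUnder (· ≥ ·) atTop φ := 
    isBoundedUnder_of ⟨0, fun t => (hφ.pos t).le⟩
  have h1 := eventually_lt_of_lt_liminf hl hb
  obtain ⟨T, hT⟩ := eventually_atTop.1 h1
  obtain ⟨t₀, -, ht₀⟩ := (isCompact_Icc (a := (0 : ℝ≥0)) (b := T)).exists_isMinOn
    ⟨0, by simp⟩ hφ.memW1infty.continuous.continuousOn
  refine ⟨min l (φ t₀), lt_min hl0 (hφ.pos _), fun t => ?_⟩
  rcases le_total t T with h | h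
  · exact (min_le_right _ _).trans (ht₀ ⟨zero_le, h⟩)
  · exact (min_le_left _ _).trans (hT t h).le

/-- A barrier argument: a continuous function that cannot increase between the levels `r` and `1`
stays below `r`. -/
theorem le_of_barrier {q : ℝ≥0 → ℝ} (hq : Continuous q) {r : ℝ} (hr : r < 1) (h0 : q 0 ≤ r)
    (h : ∀ t₀ t₁, t₀ < t₁ → (∀ s < t₁, q s < 1) → (∀ s ∈ Ioc t₀ t₁, r < q s) → q t₁ ≤ q t₀)
    (t : ℝ≥0) : q t ≤ r := by
  by_contra! ht
  -- `t₁` is `t` itself or, if `q` reaches `1` before `t`, the first time it does so; `t₀` below is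
  -- the last time up to `t₁` with `q ≤ r`.
  obtain ⟨t₁, h1, h2⟩ : ∃ t₁, r < q t₁ ∧ ∀ s < t₁, q s < 1 := by
    by_cases hC : ∀ s < t, q s < 1
    · exact ⟨t, ht, hC⟩
    · push Not at hC
      obtain ⟨s, hst, hs⟩ := hC
      have hcomp : IsCompact (Icc 0 t ∩ {s | 1 ≤ q s}) :=
        isCompact_Icc.inter_right (isClosed_le continuous_const hq)
      obtain ⟨m, hm, hm'⟩ := hcomp.exists_isLeast ⟨s, ⟨zero_le, hst.le⟩, hs⟩
      refine ⟨m, hr.trans_le hm.2, fun u hu => ?_⟩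
      by_contra! hu1
      exact absurd (hm' ⟨⟨zero_le, hu.le.trans hm.1.2⟩, hu1⟩) (not_le.2 hu)
  have hcomp : IsCompact (Icc 0 t₁ ∩ {s | q s ≤ r}) :=
    isCompact_Icc.inter_right (isClosed_le hq continuous_const)
  obtain ⟨t₀, ht₀, ht₀'⟩ := hcomp.exists_isGreatest ⟨0, ⟨le_rfl, zero_le⟩, h0⟩
  have hlt : t₀ < t₁ := lt_of_le_of_ne ht₀.1.2 fun e => absurd ht₀.2 (by simpa [e] using h1)
  have := h t₀ t₁ hlt h2 fun s hs => by
    by_contra! hs1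
    exact absurd (ht₀' ⟨⟨zero_le, hs.2⟩, hs1⟩) (not_le.2 hs.1)
  exact absurd (this.trans ht₀.2) (not_le.2 h1)

end Signals

/-! ### The saturated funnel controller -/

section Saturation

/-- `p ↦ p / (1 - p²)`, saturated at `|p| = r`. -/
def satGain (r p : ℝ) : ℝ := max (-r) (min r p) / (1 - max (-r) (min r p) ^ 2)

variable {r : ℝ}

theorem one_sub_sq_pos (hr0 : 0 ≤ r) (hr : r < 1) : 0 < 1 - r ^ 2 := by nlinarith

theorem one_sub_sat_sq_le (hr0 : 0 ≤ r) (p : ℝ) :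
    1 - r ^ 2 ≤ 1 - max (-r) (min r p) ^ 2 := by
  have h : |max (-r) (min r p)| ≤ r :=
    abs_le.2 ⟨le_max_left _ _, max_le (by linarith) (min_le_left _ _)⟩
  have := sq_le_sq' (abs_le.1 h).1 (abs_le.1 h).2
  linarith

theorem satGain_of_abs_le {p : ℝ} (hp : |p| ≤ r) : satGain r p = p / (1 - p ^ 2) := by
  rw [satGain, min_eq_right (abs_le.1 hp).2, max_eq_right (abs_le.1 hp).1]

theorem satGain_of_le (hr0 : 0 ≤ r) {p : ℝ} (hp : r ≤ p) : satGain r p = r / (1 - r ^ 2) := by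
  rw [satGain, min_eq_left hp, max_eq_right (by linarith)]

theorem satGain_of_le_neg (hr0 : 0 ≤ r) {p : ℝ} (hp : p ≤ -r) :
    satGain r p = -(r / (1 - r ^ 2)) := by
  rw [satGain, min_eq_right (by linarith), max_eq_left hp, neg_sq, neg_div]

theorem continuous_satGain (hr0 : 0 ≤ r) (hr : r < 1) : Continuous (satGain r) := by
  unfold satGain
  refine Continuous.div (by fun_prop) (by fun_prop) fun p => ?_
  exact ((one_sub_sq_pos hr0 hr).trans_le (one_sub_sat_sq_le hr0 p)).ne'

theorem abs_satGain_sub_le (hr0 : 0 ≤ r) (hr : r < 1) (p q : ℝ) :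
    |satGain r p - satGain r q| ≤ 2 / (1 - r ^ 2) ^ 2 * |p - q| := by
  have h0 := one_sub_sq_pos hr0 hr
  have hp := one_sub_sat_sq_le hr0 p
  have hq := one_sub_sat_sq_le hr0 q
  have hpq : |max (-r) (min r p) - max (-r) (min r q)| ≤ |p - q| :=
    calc _ ≤ |min r p - min r q| := by
          simpa using abs_max_sub_max_le_max (-r) (min r p) (-r) (min r q)
      _ ≤ _ := by simpa using abs_min_sub_min_le_max r p r q
  unfold satGain
  set P := max (-r) (min r p)
  set Q := max (-r) (min r q)
  -- This identity replaces a derivative bound: `|1 + P Q| ≤ 2`, and both denominators are at least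
  -- `1 - r²`.
  have e : P / (1 - P ^ 2) - Q / (1 - Q ^ 2) =
      (1 + P * Q) / ((1 - P ^ 2) * (1 - Q ^ 2)) * (P - Q) := by
    have h1 : (1 - P ^ 2) ≠ 0 := (h0.trans_le hp).ne'
    have h2 : (1 - Q ^ 2) ≠ 0 := (h0.trans_le hq).ne'
    field_simp
    ring
  rw [e, abs_mul, abs_div, abs_of_pos (mul_pos (h0.trans_le hp) (h0.trans_le hq)), sq (1 - r ^ 2)]
  have h3 : |1 + P * Q| ≤ 2 := by
    rw [abs_le]
    constructor <;> nlinarith [sq_nonneg (P - Q), sq_nonneg (P + Q)]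
  have hP0 : 0 ≤ 1 - P ^ 2 := h0.le.trans hp
  gcongr

end Saturation

/-! ### The closed loop with the saturated funnel controller -/

section ClosedLoop

/-- The funnel controller, saturated at distance `1 - r` from the boundary of the funnel. -/
def satControl (φ : ℝ≥0 → ℝ) (r : ℝ) (t : ℝ≥0) (e : ℝ) : ℝ := -((φ t)⁻¹ * satGain r (φ t * e))

variable {φ : ℝ≥0 → ℝ} {r : ℝ}

theorem satControl_of_abs_le (hφ : ∀ t, 0 < φ t) {e : ℝ≥0 → ℝ} {t : ℝ≥0} (h : φ t * |e t| ≤ r) :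
    satControl φ r t (e t) = funnelControl φ e t := by
  have h1 : |φ t * e t| ≤ r := by rwa [abs_mul, abs_of_pos (hφ t)]
  have := (hφ t).ne'
  rw [satControl, satGain_of_abs_le h1, funnelControl, mul_pow]
  field_simp

/-- The factors `φ` and `φ⁻¹` cancel, so the Lipschitz constant is uniform in time. -/
theorem abs_satControl_sub_le (hφ : ∀ t, 0 < φ t) (hr0 : 0 ≤ r) (hr : r < 1) (t : ℝ≥0)
    (e e' : ℝ) : |satControl φ r t e - satControl φ r t e'| ≤ 2 / (1 - r ^ 2) ^ 2 * |e - e'| := by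
  have h := abs_satGain_sub_le hr0 hr (φ t * e) (φ t * e')
  have h0 := hφ t
  have e1 : satControl φ r t e - satControl φ r t e' =
      -((φ t)⁻¹ * (satGain r (φ t * e) - satGain r (φ t * e'))) := by
    rw [satControl, satControl]; ring
  rw [e1, abs_neg, abs_mul, abs_inv, abs_of_pos h0, inv_mul_le_iff₀ h0]
  rw [← mul_sub, abs_mul, abs_of_pos h0] at h
  linarith

theorem continuous_satControl (hφ : ∀ t, 0 < φ t) (hφc : Continuous φ) (hr0 : 0 ≤ r) (hr : r < 1)
    {X : Type*} [TopologicalSpace X] {t : X → ℝ≥0} {e : X → ℝ} (ht : Continuous t)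
    (he : Continuous e) : Continuous fun p => satControl φ r (t p) (e p) := by
  unfold satControl
  have h1 : Continuous fun p => φ (t p) := hφc.comp ht
  exact ((h1.inv₀ fun p => (hφ _).ne').mul
    ((continuous_satGain hr0 hr).comp (h1.mul he))).neg

variable {H : Type*} [NormedAddCommGroup H] [InnerProductSpace ℝ H] {f : H → H}

theorem exists_lipschitz_closedLoop (hf : ∃ L : ℝ≥0, LipschitzWith L f) (b c : H)
    (hφ : ∀ t, 0 < φ t) (hr0 : 0 ≤ r) (hr : r < 1) : ∃ K : ℝ, 0 ≤ K ∧ ∀ (t : ℝ≥0) (y δ : ℝ)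
      (x x' : H), ‖(f x + (satControl φ r t (⟪x, c⟫ - y) + δ) • b) -
        (f x' + (satControl φ r t (⟪x', c⟫ - y) + δ) • b)‖ ≤ K * ‖x - x'‖ := by
  obtain ⟨L, hL⟩ := hf
  refine ⟨L + 2 / (1 - r ^ 2) ^ 2 * ‖c‖ * ‖b‖, by positivity, fun t y δ x x' => ?_⟩
  rw [add_sub_add_comm, ← sub_smul, add_sub_add_right_eq_sub, add_mul]
  refine (norm_add_le _ _).trans (add_le_add (hL.norm_sub_le _ _) ?_)
  rw [norm_smul, Real.norm_eq_abs]
  have h1 := abs_satControl_sub_le hφ hr0 hr t (⟪x, c⟫ - y) (⟪x', c⟫ - y)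
  rw [sub_sub_sub_cancel_right, ← inner_sub_left] at h1
  have h2 : |⟪x - x', c⟫| ≤ ‖x - x'‖ * ‖c‖ := abs_real_inner_le_norm _ _
  have h3 := one_sub_sq_pos hr0 hr
  calc _ ≤ 2 / (1 - r ^ 2) ^ 2 * (‖x - x'‖ * ‖c‖) * ‖b‖ := by
        gcongr
        exact h1.trans (by gcongr)
    _ = _ := by ring

variable [CompleteSpace H] {A : H →ₗ.[ℝ] H}

theorem exists_saturated_solution (hA : GeneratesC0Semigroup A)
    (hf : ∃ L : ℝ≥0, LipschitzWith L f) (b c : H) (hφ : ∀ t, 0 < φ t) (hφc : Continuous φ)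
    (hr0 : 0 ≤ r) (hr : r < 1) {d yref : ℝ≥0 → ℝ} (hd : MemLinfty d) (hy : Continuous yref)
    (x₀ : H) : ∃ x : C(ℝ≥0, H), IsMildSolution A x₀
      (fun s => f (x s) + (satControl φ r s (⟪x s, c⟫ - yref s) + d s) • b) ∞ x := by
  obtain ⟨S, hS⟩ := hA
  obtain ⟨K, hK0, hK⟩ := exists_lipschitz_closedLoop hf b c hφ hr0 hr
  obtain ⟨L, hL⟩ := hf
  have hfc := hL.continuous
  have hdb : LocallyIntegrable fun s : ℝ => d s.toNNReal • b :=
    locallyIntegrable_smul_const hd.memLinftyLoc.locallyIntegrable b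
  have hG : Continuous (Function.uncurry fun (s : ℝ) (z : H) =>
      f z + satControl φ r s.toNNReal (⟪z, c⟫ - yref s.toNNReal) • b) := by
    have h1 : Continuous fun p : ℝ × H => p.1.toNNReal := by fun_prop
    have h2 : Continuous fun p : ℝ × H => ⟪p.2, c⟫ - yref p.1.toNNReal := by fun_prop
    have h3 := continuous_satControl hφ hφc hr0 hr h1 h2
    simp only [Function.uncurry_def]
    fun_prop
  -- The disturbance is only measurable, so its contribution goes into the continuous inhomogeneity
  -- `S.mild x₀ (d b)`, and the remaining nonlinearity is continuous.
  obtain ⟨z, hz, e⟩ := S.exists_integral_eq (L := K) hG hK0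
    (fun s z w => by simpa using hK s.toNNReal (yref s.toNNReal) 0 z w)
    (S.continuous_mild x₀ hdb)
  refine ⟨⟨fun t => z t, hz.comp NNReal.continuous_coe⟩,
    (isMildSolution_top_iff hS).2 ⟨hz.comp NNReal.continuous_coe, fun t => ?_⟩⟩
  change z t = _
  have hGz := hG.comp (continuous_id.prodMk hz)
  have hi1 := S.intervalIntegrable_opReal t (hGz.intervalIntegrable (μ := volume) 0 t)
  have hi2 := S.intervalIntegrable_opReal t (intervalIntegrable_of_locallyIntegrable hdb 0 t)
  rw [e t t.coe_nonneg, C0Semigroup.mild, C0Semigroup.mild, add_assoc]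
  refine congrArg _ ((intervalIntegral.integral_add hi2 hi1).symm.trans ?_)
  apply intervalIntegral.integral_congr
  intro s hs
  rw [uIcc_of_le t.coe_nonneg] at hs
  simp only [ContinuousMap.coe_mk, Real.coe_toNNReal s hs.1, ← map_add, Function.comp_apply,
    Function.uncurry_apply_pair, id, add_smul]
  congr 1
  abel

/-- Solutions of the closed loop are unique. -/
theorem IsClosedLoopSolution.eq (hA : GeneratesC0Semigroup A)
    (hf : ∃ L : ℝ≥0, LipschitzWith L f) {b c : H} (hφ : ∀ t, 0 < φ t) (hφc : Continuous φ)
    {d yref : ℝ≥0 → ℝ} (hd : MemLinfty d) (hy : Continuous yref) {x₀ : H} {ω ω' : ℝ≥0∞}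
    {x x' : ℝ≥0 → H} (hx : IsClosedLoopSolution A f b c d yref φ x₀ ω x)
    (hx' : IsClosedLoopSolution A f b c d yref φ x₀ ω' x') {t : ℝ≥0} (ht : (t : ℝ≥0∞) < ω)
    (ht' : (t : ℝ≥0∞) < ω') : x t = x' t := by
  obtain ⟨S, hS⟩ := hA
  have key {ω : ℝ≥0∞} {x : ℝ≥0 → H} (hx : IsClosedLoopSolution A f b c d yref φ x₀ ω x)
      (ht : (t : ℝ≥0∞) < ω) : ∃ r₀ < 1, 0 ≤ r₀ ∧ ∀ r, r₀ ≤ r → r < 1 → ∃ z : ℝ → H,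
        Continuous z ∧ z t = x t ∧
        IntervalIntegrable (fun s : ℝ => f (z s) + (satControl φ r s.toNNReal
          (⟪z s, c⟫ - yref s.toNNReal) + d s.toNNReal) • b) volume 0 t ∧
        ∀ s ∈ Icc (0 : ℝ) t, z s = S.opReal s x₀ + ∫ r' in (0 : ℝ)..s, S.opReal (s - r')
          (f (z r') + (satControl φ r r'.toNNReal (⟪z r', c⟫ - yref r'.toNNReal) +
            d r'.toNNReal) • b) := by
    obtain ⟨hfun, hm⟩ := hx
    obtain ⟨hc, e⟩ := (isMildSolution_iff hS).1 hm
    have hlt (s : ℝ≥0) (hs : s ≤ t) : (s : ℝ≥0∞) < ω := (ENNReal.coe_le_coe.2 hs).trans_lt ht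
    -- Freezing `x` at time `t` gives a globally continuous function. The maximum of `φ |e|` over
    -- `[0, t]` is a level `r₀ < 1`, and `x` solves the saturated equation for every `r ∈ [r₀, 1)`.
    -- Two solutions can thus be compared at the larger of their levels.
    have hcs : Continuous fun s => x (min s t) := by
      rw [← continuousOn_univ]
      exact hc.comp (by fun_prop) fun s _ => hlt _ (min_le_right _ _)
    have hec : Continuous fun s => φ (min s t) * |trackingError c yref x (min s t)| := by
      have hm : Continuous fun s => min s t := by fun_prop
      exact (hφc.comp hm).mul ((hcs.inner continuous_const).sub (hy.comp hm)).abs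
    obtain ⟨s₀, hs₀, hmax⟩ := (isCompact_Icc (a := (0 : ℝ≥0)) (b := t)).exists_isMaxOn
      ⟨0, by simp⟩ hec.continuousOn
    refine ⟨_, hfun (min s₀ t) (hlt _ (min_le_right _ _)),
      mul_nonneg (hφ _).le (abs_nonneg _), fun r hr₀ hr => ?_⟩
    have hr0 : 0 ≤ r := (mul_nonneg (hφ _).le (abs_nonneg _)).trans hr₀
    have hfr (s : ℝ≥0) (hs : s ≤ t) : φ s * |trackingError c yref x s| ≤ r := by
      have h1 := hmax (show s ∈ Icc 0 t from ⟨zero_le, hs⟩)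
      simp only [mem_ofPred_eq, min_eq_left hs] at h1
      exact h1.trans hr₀
    have hz : Continuous fun s : ℝ => x (min s.toNNReal t) := hcs.comp continuous_real_toNNReal
    refine ⟨fun s => x (min s.toNNReal t), hz, by simp, ?_, fun s hs => ?_⟩
    · obtain ⟨L, hL⟩ := hf
      have h1 : Continuous fun s : ℝ => f (x (min s.toNNReal t)) := hL.continuous.comp hz
      have h2 : Continuous fun s : ℝ => satControl φ r s.toNNReal
          (⟪x (min s.toNNReal t), c⟫ - yref s.toNNReal) :=
        continuous_satControl hφ hφc hr0 hr continuous_real_toNNReal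
          ((hz.inner continuous_const).sub (hy.comp continuous_real_toNNReal))
      have h3 := (h2.locallyIntegrable (μ := volume)).add hd.memLinftyLoc.locallyIntegrable
      exact intervalIntegrable_of_locallyIntegrable
        ((h1.locallyIntegrable (μ := volume)).add (locallyIntegrable_smul_const h3 b)) _ _
    · have hst : s.toNNReal ≤ t := Real.toNNReal_le_iff_le_coe.2 hs.2
      have h1 := e s.toNNReal (hlt _ hst)
      rw [Real.coe_toNNReal s hs.1, C0Semigroup.mild] at h1
      dsimp only
      rw [min_eq_left hst, h1]
      congr 1
      apply intervalIntegral.integral_congr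
      intro s' hs'
      rw [uIcc_of_le hs.1] at hs'
      have hst' : s'.toNNReal ≤ t := (Real.toNNReal_le_toNNReal hs'.2).trans hst
      dsimp only
      rw [min_eq_left hst', ← satControl_of_abs_le hφ (hfr _ hst')]
      rfl
  obtain ⟨r₁, h1, h10, k₁⟩ := key hx ht
  obtain ⟨r₂, h2, h20, k₂⟩ := key hx' ht'
  have hr : max r₁ r₂ < 1 := max_lt h1 h2
  have hr0 : 0 ≤ max r₁ r₂ := h10.trans (le_max_left _ _)
  obtain ⟨z₁, hz₁, e₁, i₁, m₁⟩ := k₁ _ (le_max_left r₁ r₂) hr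
  obtain ⟨z₂, hz₂, e₂, i₂, m₂⟩ := k₂ _ (le_max_right r₁ r₂) hr
  obtain ⟨K, hK0, hK⟩ := exists_lipschitz_closedLoop hf b c hφ hr0 hr
  rw [← e₁, ← e₂]
  exact S.eqOn_of_integral_eq hK0 (G := fun s z => f z + (satControl φ (max r₁ r₂) s.toNNReal
    (⟪z, c⟫ - yref s.toNNReal) + d s.toNNReal) • b) (fun s z w => hK _ _ _ _ _) hz₁ hz₂ i₁ i₂ m₁ m₂
    ⟨t.coe_nonneg, le_rfl⟩

end ClosedLoop

/-! ### Invariance of the funnel -/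

section Feasibility

/-- BIBO localised in time: freezing the input at some `t' < t` makes it globally bounded, and by
causality this does not change `T y` before `t'`. -/
theorem IsAdmissibleOperator.exists_bound {T : C(ℝ≥0, ℝ) → ℝ≥0 → ℝ} (hT : IsAdmissibleOperator T)
    {k₁ : ℝ} (hk₁ : 0 < k₁) : ∃ k₂ : ℝ, 0 < k₂ ∧ ∀ (y : C(ℝ≥0, ℝ)) (t : ℝ≥0),
      (∀ s < t, |y s| ≤ k₁) → ∀ s < t, |T y s| ≤ k₂ := by
  obtain ⟨k₂, hk₂, h⟩ := hT.bibo k₁ hk₁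
  refine ⟨k₂, hk₂, fun y t hy s hs => ?_⟩
  obtain ⟨t', hst', ht'⟩ := exists_between hs
  let y' : C(ℝ≥0, ℝ) := ⟨fun r => y (min r t'), by fun_prop⟩
  rw [hT.causal t' y y' (fun r hr => by simp [y', min_eq_left hr.le]) s hst']
  exact h y' (fun r => hy _ ((min_le_right _ _).trans_lt ht')) s

/-- A change of sign would force a zero by the intermediate value theorem, where `r < |p|` fails. -/
theorem forall_lt_of_forall_lt_abs {p : ℝ≥0 → ℝ} (hp : Continuous p) {r : ℝ} (hr : 0 ≤ r)
    {t₀ t₁ : ℝ≥0} (h : ∀ s ∈ Ioc t₀ t₁, r < |p s|) (h1 : 0 < p t₁) :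
    ∀ s ∈ Ioc t₀ t₁, r < p s := by
  intro s hs
  by_contra! hps
  have h2 : p s ≤ 0 := by
    by_contra! h3
    have := h s hs
    rw [abs_of_pos h3] at this
    linarith
  obtain ⟨u, hu, hu0⟩ := intermediate_value_Icc hs.2 hp.continuousOn ⟨h2, h1.le⟩
  have := h u ⟨hs.1.trans_le hu.1, hu.2⟩
  rw [hu0, abs_zero] at this
  linarith

theorem exists_level (κ q : ℝ) (hq : q < 1) : ∃ r, 0 < r ∧ r < 1 ∧ q ≤ r ∧ κ ≤ r / (1 - r ^ 2) := by
  -- With `1 - r ≤ 1 / δ` one has `1 - r² ≤ 2 / δ`, hence `κ (1 - r²) ≤ 1 / 2 ≤ r`.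
  set δ : ℝ := 4 * (|κ| + 1) with hδ
  have hδ4 : 4 ≤ δ := by linarith [abs_nonneg κ]
  have hδ0 : 0 < δ := by linarith
  refine ⟨max q (1 - 1 / δ), ?_, max_lt hq (by linarith [one_div_pos.2 hδ0]), le_max_left _ _, ?_⟩
  · have : 1 / δ ≤ 1 / 4 := one_div_le_one_div_of_le (by norm_num) hδ4
    exact lt_of_lt_of_le (by linarith) (le_max_right _ _)
  · set r := max q (1 - 1 / δ) with hr
    have h1 : r < 1 := max_lt hq (by linarith [one_div_pos.2 hδ0])
    have h2 : 1 - 1 / δ ≤ r := le_max_right _ _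
    have h3 : 1 / δ ≤ 1 / 4 := one_div_le_one_div_of_le (by norm_num) hδ4
    have h4 : 1 - r ^ 2 ≤ 2 * (1 / δ) := by nlinarith
    have h5 : 0 < 1 - r ^ 2 := one_sub_sq_pos (by linarith) h1
    rw [le_div_iff₀ h5]
    calc κ * (1 - r ^ 2) ≤ |κ| * (1 - r ^ 2) := by gcongr; exact le_abs_self κ
      _ ≤ |κ| * (2 * (1 / δ)) := by gcongr
      _ ≤ 1 / 2 := by
          rw [hδ]
          have := abs_nonneg κ
          rw [show |κ| * (2 * (1 / (4 * (|κ| + 1)))) = 1 / 2 * (|κ| / (|κ| + 1)) by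
            field_simp; ring]
          have : |κ| / (|κ| + 1) ≤ 1 := by rw [div_le_one (by positivity)]; linarith
          linarith
      _ ≤ r := by linarith

variable {H : Type*} [NormedAddCommGroup H] [InnerProductSpace ℝ H] [CompleteSpace H]
variable {A : H →ₗ.[ℝ] H} {f : H → H} {b : A.domain} {c : A†.domain}

/-- The funnel is invariant under the saturated closed loop, if the saturation level is close enough
to the boundary of the funnel. -/
theorem exists_invariant_level (hA : GeneratesC0Semigroup A)
    (hf : ∃ L : ℝ≥0, LipschitzWith L f) (hbc : 0 < ⟪(b : H), (c : H)⟫)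
    (hB : IsBISBOStable A f b c) {d yref φ : ℝ≥0 → ℝ} (hd : MemLinfty d) (hy : MemW1infty yref)
    (hφ : IsFunnelFunction φ) {x₀ : H} (h0 : φ 0 * |⟪x₀, (c : H)⟫ - yref 0| < 1) :
    ∃ r, 0 < r ∧ r < 1 ∧ ∀ x : C(ℝ≥0, H), IsMildSolution A x₀ (fun s => f (x s) +
      (satControl φ r s (⟪x s, (c : H)⟫ - yref s) + d s) • (b : H)) ∞ x →
      ∀ t, φ t * |⟪x t, (c : H)⟫ - yref t| ≤ r := by
  have hcb : ⟪(c : H), (b : H)⟫ ≠ 0 := by rw [real_inner_comm]; exact hbc.ne'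
  set γ := ⟪(b : H), (c : H)⟫ with hγ
  have hφc := hφ.memW1infty.continuous
  obtain ⟨m, hm0, hm⟩ := hφ.exists_lower_bound
  obtain ⟨Mφ, hMφ0, hMφ⟩ := hφ.memW1infty.exists_bound
  obtain ⟨Kφ, hKφ0, hKφ⟩ := hφ.memW1infty.exists_lipschitz
  obtain ⟨Y, hY0, hY⟩ := hy.exists_bound
  obtain ⟨Ky, hKy0, hKy⟩ := hy.exists_lipschitz
  obtain ⟨D, hD0, hD⟩ := hd.exists_ae_bound
  have hT := isAdmissibleOperator_outputOperator hA hf hcb hB (projI (b : H) x₀)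
  -- Inside the funnel `|e| ≤ 1 / m`, so `|y| ≤ 1 / m + Y`. The bound `k₂` is thus fixed before `r`
  -- is chosen.
  obtain ⟨k₂, hk₂0, hk₂⟩ := hT.exists_bound (k₁ := 1 / m + Y) (by positivity)
  obtain ⟨r, hr0, hr1, hqr, hκ⟩ :=
    exists_level (Mφ * ((k₂ + γ * D + Ky + Kφ * (1 / m) / m) / γ)) _ h0
  refine ⟨r, hr0, hr1, fun x hx => ?_⟩
  let y : C(ℝ≥0, ℝ) := ⟨fun t => ⟪x t, (c : H)⟫, by fun_prop⟩
  set e : ℝ≥0 → ℝ := fun t => ⟪x t, (c : H)⟫ - yref t with he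
  have hyc := hy.continuous
  have hec : Continuous e := by simp only [he]; fun_prop
  have hpc : Continuous fun t => φ t * e t := hφc.mul hec
  have hsatc : Continuous fun s => satControl φ r s (e s) :=
    continuous_satControl hφ.pos hφc hr0.le hr1 continuous_id hec
  have hv : MemLinftyLoc fun s => satControl φ r s (e s) + d s := fun t =>
    (memLinftyLoc_of_continuous hsatc t).add (hd.memLinftyLoc t)
  obtain ⟨-, hout⟩ := byrnesIsidori_form hA hf hcb hv hx (y := y) (fun _ => rfl)
  have hx0 : x 0 = x₀ := by
    obtain ⟨S, hS⟩ := hA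
    have := ((isMildSolution_top_iff hS).1 hx).2 0
    simpa using this
  set Ty := outputOperator A f b c (projI (b : H) x₀) y with hTy
  have hint : LocallyIntegrable fun s : ℝ =>
      Ty s.toNNReal + γ * (satControl φ r s.toNNReal (e s.toNNReal) + d s.toNNReal) :=
    (hT.memLinftyLoc y).locallyIntegrable.add (hv.locallyIntegrable.smul γ)
  have hinti := fun a b => intervalIntegrable_of_locallyIntegrable hint a b
  set κ := (Mφ)⁻¹ * (r / (1 - r ^ 2)) with hκdef
  have hκ' : (k₂ + γ * D + Ky) + Kφ * (1 / m) / m ≤ γ * κ := by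
    rw [hκdef, ← div_le_iff₀' hbc, le_inv_mul_iff₀ hMφ0]
    exact hκ
  have hκ0 : 0 ≤ r / (1 - r ^ 2) := div_nonneg hr0.le (one_sub_sq_pos hr0.le hr1).le
  refine le_of_barrier (by fun_prop) hr1 (by rw [hx0]; exact hqr) fun t₀ t₁ h01 hlt hgt => ?_
  have h01' : (t₀ : ℝ) < t₁ := h01
  have habs (t : ℝ≥0) : φ t * |e t| = |φ t * e t| := by rw [abs_mul, abs_of_pos (hφ.pos t)]
  have hEb (s : ℝ≥0) (hs : s < t₁) : |e s| ≤ 1 / m := by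
    rw [le_div_iff₀ hm0, mul_comm]
    exact (mul_le_mul_of_nonneg_right (hm s) (abs_nonneg _)).trans (hlt s hs).le
  have hTb (s : ℝ≥0) (hs : s < t₁) : |Ty s| ≤ k₂ := hk₂ y t₁ (fun u hu => by
    have h1 : y u = e u + yref u := by simp [he, y]
    rw [h1]
    exact (abs_add_le _ _).trans (add_le_add (hEb u hu) (hY u))) s hs
  -- `σ = ±1` stands for the sign of `e`, so both sides of the funnel are treated at once.
  have hinc (σ : ℝ) (hσ : |σ| = 1)
      (hsat : ∀ s ∈ Ioc t₀ t₁, σ * satControl φ r s (e s) ≤ -κ) :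
      σ * (e t₁ - e t₀) ≤ (k₂ + γ * D + Ky - γ * κ) * (t₁ - t₀) := by
    have h1 : e t₁ - e t₀ = (∫ s in (t₀ : ℝ)..t₁, (Ty s.toNNReal +
        γ * (satControl φ r s.toNNReal (e s.toNNReal) + d s.toNNReal))) -
          (yref t₁ - yref t₀) := by
      rw [← intervalIntegral.integral_interval_sub_left (hinti 0 t₁) (hinti 0 t₀)]
      have e₁ := hout t₁
      have e₀ := hout t₀
      change ⟪x t₁, (c : H)⟫ = _ at e₁
      change ⟪x t₀, (c : H)⟫ = _ at e₀
      simp only [he]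
      rw [e₁, e₀]
      ring
    have h2 : σ * (∫ s in (t₀ : ℝ)..t₁, (Ty s.toNNReal +
        γ * (satControl φ r s.toNNReal (e s.toNNReal) + d s.toNNReal))) ≤
          (k₂ + γ * D - γ * κ) * (t₁ - t₀) := by
      rw [← intervalIntegral.integral_const_mul]
      -- The endpoints are discarded: the saturation bound is known only after `t₀` and the bound on
      -- `T y` only before `t₁`.
      have hne (a : ℝ) : ∀ᵐ s : ℝ, s ≠ a := by simp [ae_iff]
      have h3 := intervalIntegral.integral_mono_ae_restrict (μ := volume) h01'.le
        ((hinti t₀ t₁).const_mul σ)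
        (continuous_const (y := k₂ + γ * D - γ * κ) |>.intervalIntegrable t₀ t₁) (by
          filter_upwards [ae_restrict_mem measurableSet_Icc, ae_restrict_of_ae hD,
            ae_restrict_of_ae (hne t₀), ae_restrict_of_ae (hne t₁)] with s hs hDs hs₀ hs₁
          have hs0 : 0 ≤ s := t₀.coe_nonneg.trans hs.1
          have hst₀ : t₀ < s.toNNReal := Real.lt_toNNReal_iff_coe_lt.2 (lt_of_le_of_ne' hs.1 hs₀)
          have hst₁ : s.toNNReal < t₁ :=
            (Real.toNNReal_lt_iff_lt_coe hs0).2 (lt_of_le_of_ne hs.2 hs₁)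
          have h4 := hsat _ ⟨hst₀, hst₁.le⟩
          have h5 : σ * Ty s.toNNReal ≤ k₂ := by
            refine (le_abs_self _).trans ?_
            rw [abs_mul, hσ, one_mul]
            exact hTb _ hst₁
          have h6 : σ * d s.toNNReal ≤ D := by
            refine (le_abs_self _).trans ?_
            rw [abs_mul, hσ, one_mul]
            exact hDs hs0
          have h7 : γ * (σ * satControl φ r s.toNNReal (e s.toNNReal) + σ * d s.toNNReal) ≤
              γ * (-κ + D) := mul_le_mul_of_nonneg_left (add_le_add h4 h6) hbc.le
          calc σ * (Ty s.toNNReal + γ * (satControl φ r s.toNNReal (e s.toNNReal) + d s.toNNReal)) =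
                σ * Ty s.toNNReal + γ * (σ * satControl φ r s.toNNReal (e s.toNNReal) +
                  σ * d s.toNNReal) := by ring
            _ ≤ k₂ + γ * (-κ + D) := add_le_add h5 h7
            _ = k₂ + γ * D - γ * κ := by ring)
      rw [intervalIntegral.integral_const, smul_eq_mul, mul_comm ((t₁ : ℝ) - t₀)] at h3
      exact h3
    have h3 : -(σ * (yref t₁ - yref t₀)) ≤ Ky * (t₁ - t₀) := by
      refine (neg_le_abs _).trans ?_
      rw [abs_mul, hσ, one_mul]
      exact hKy t₀ t₁ h01.le
    rw [h1, mul_sub]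
    linarith
  have hfin (σ : ℝ) (hσ : |σ| = 1) (hpos : |φ t₁ * e t₁| = σ * (φ t₁ * e t₁))
      (hsat : ∀ s ∈ Ioc t₀ t₁, σ * satControl φ r s (e s) ≤ -κ) :
      φ t₁ * |e t₁| ≤ φ t₀ * |e t₀| := by
    have h1 := hinc σ hσ hsat
    have h2 : σ * e t₀ * (φ t₁ - φ t₀) ≤ 1 / m * (Kφ * (t₁ - t₀)) := by
      refine (le_abs_self _).trans ?_
      rw [abs_mul, abs_mul, hσ, one_mul]
      exact mul_le_mul (hEb t₀ h01) (hKφ t₀ t₁ h01.le) (abs_nonneg _) (by positivity)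
    have h3 : φ t₁ * (σ * (e t₁ - e t₀)) ≤ -(1 / m * Kφ) * (t₁ - t₀) := by
      have h4 : σ * (e t₁ - e t₀) ≤ -(Kφ * (1 / m) / m * (t₁ - t₀)) := by
        refine h1.trans ?_
        rw [← neg_mul]
        exact mul_le_mul_of_nonneg_right (by linarith) (by linarith)
      have h5 : 0 ≤ Kφ * (1 / m) / m * (t₁ - t₀) :=
        mul_nonneg (by positivity) (by linarith)
      calc φ t₁ * (σ * (e t₁ - e t₀)) ≤ φ t₁ * -(Kφ * (1 / m) / m * (t₁ - t₀)) :=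
            mul_le_mul_of_nonneg_left h4 (hφ.pos _).le
        _ ≤ m * -(Kφ * (1 / m) / m * (t₁ - t₀)) :=
            mul_le_mul_of_nonpos_right (hm t₁) (by linarith)
        _ = _ := by field_simp
    have h6 : σ * (φ t₀ * e t₀) ≤ |φ t₀ * e t₀| := by
      refine (le_abs_self _).trans ?_
      rw [abs_mul, hσ, one_mul]
    rw [habs, habs, hpos]
    -- A product rule for increments: the first term is at most `-(Kφ / m) (t₁ - t₀)` by `h3`, and
    -- by `h2` the second does not exceed the opposite amount.
    have h7 : σ * (φ t₁ * e t₁) = φ t₁ * (σ * (e t₁ - e t₀)) + σ * e t₀ * (φ t₁ - φ t₀) +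
      σ * (φ t₀ * e t₀) := by ring
    linarith
  have hgain (s : ℝ≥0) : κ ≤ (φ s)⁻¹ * (r / (1 - r ^ 2)) := by
    rw [hκdef]
    refine mul_le_mul_of_nonneg_right ?_ hκ0
    exact inv_anti₀ (hφ.pos s) ((le_abs_self _).trans (hMφ s))
  have hgt' : ∀ s ∈ Ioc t₀ t₁, r < |φ s * e s| := fun s hs => habs s ▸ hgt s hs
  rcases lt_trichotomy (φ t₁ * e t₁) 0 with hneg | hzero | hpos
  · have h1 := forall_lt_of_forall_lt_abs (p := fun t => -(φ t * e t)) hpc.neg hr0.le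
      (fun s hs => by rw [abs_neg]; exact hgt' s hs) (by linarith)
    refine hfin (-1) (by simp) (by rw [abs_of_neg hneg]; ring) fun s hs => ?_
    rw [satControl, satGain_of_le_neg hr0.le (by linarith [h1 s hs])]
    linarith [hgain s]
  · have := hgt' t₁ ⟨h01, le_rfl⟩
    rw [hzero, abs_zero] at this
    linarith
  · have h1 := forall_lt_of_forall_lt_abs hpc hr0.le hgt' hpos
    refine hfin 1 (by simp) (by rw [abs_of_pos hpos]; ring) fun s hs => ?_
    rw [satControl, satGain_of_le hr0.le (h1 s hs).le]
    linarith [hgain s]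

/-- The funnel controller is feasible. -/
theorem funnelControl_feasible (hA : GeneratesC0Semigroup A)
    (hf : ∃ L : ℝ≥0, LipschitzWith L f) (hbc : 0 < ⟪(b : H), (c : H)⟫)
    (hB : IsBISBOStable A f b c) {d yref φ : ℝ≥0 → ℝ} (hd : MemLinfty d) (hy : MemW1infty yref)
    (hφ : IsFunnelFunction φ) {x₀ : H} (h0 : φ 0 * |⟪x₀, (c : H)⟫ - yref 0| < 1) :
    ∃ x : ℝ≥0 → H, IsClosedLoopSolution A f (b : H) (c : H) d yref φ x₀ ∞ x ∧
      (∀ (ω : ℝ≥0∞) (x' : ℝ≥0 → H),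
        IsClosedLoopSolution A f (b : H) (c : H) d yref φ x₀ ω x' →
        ∀ t : ℝ≥0, (t : ℝ≥0∞) < ω → x' t = x t) ∧
      (∃ M : ℝ, ∀ t : ℝ≥0, |funnelControl φ (trackingError (c : H) yref x) t| ≤ M ∧
        |funnelGain φ (trackingError (c : H) yref x) t| ≤ M ∧ |⟪x t, (c : H)⟫| ≤ M) ∧
      ∃ ε : ℝ, 0 < ε ∧ ∀ t : ℝ≥0, |trackingError (c : H) yref x t| ≤ 1 / φ t - ε := by
  obtain ⟨r, hr0, hr1, hr⟩ := exists_invariant_level hA hf hbc hB hd hy hφ h0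
  have hφc := hφ.memW1infty.continuous
  obtain ⟨x, hx⟩ := exists_saturated_solution hA hf (b : H) (c : H) hφ.pos hφc hr0.le hr1 hd
    hy.continuous x₀
  have hxr (t : ℝ≥0) : φ t * |trackingError (c : H) yref x t| ≤ r := hr x hx t
  have hcl : IsClosedLoopSolution A f (b : H) (c : H) d yref φ x₀ ∞ x := by
    refine ⟨fun t _ => (hxr t).trans_lt hr1, ?_⟩
    convert hx using 5 with s
    exact (satControl_of_abs_le hφ.pos (hxr s)).symm
  obtain ⟨m, hm0, hm⟩ := hφ.exists_lower_bound
  obtain ⟨Mφ, hMφ0, hMφ⟩ := hφ.memW1infty.exists_bound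
  obtain ⟨Y, hY0, hY⟩ := hy.exists_bound
  have h1r := one_sub_sq_pos hr0.le hr1
  have he (t : ℝ≥0) : |trackingError (c : H) yref x t| ≤ 1 / m := by
    rw [le_div_iff₀ hm0, mul_comm]
    exact (mul_le_mul_of_nonneg_right (hm t) (abs_nonneg _)).trans ((hxr t).trans hr1.le)
  have hden (t : ℝ≥0) : 1 - r ^ 2 ≤ 1 - φ t ^ 2 * trackingError (c : H) yref x t ^ 2 := by
    have h1 : (φ t * |trackingError (c : H) yref x t|) ^ 2 ≤ r ^ 2 :=
      pow_le_pow_left₀ (mul_nonneg (hφ.pos t).le (abs_nonneg _)) (hxr t) 2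
    rw [mul_pow, sq_abs] at h1
    linarith
  refine ⟨x, hcl, fun ω x' hx' t ht => hx'.eq hA hf hφ.pos hφc hd hy.continuous hcl ht
    ENNReal.coe_lt_top, ⟨max (1 / m / (1 - r ^ 2)) (max (1 / (1 - r ^ 2)) (1 / m + Y)),
    fun t => ⟨le_max_of_le_left ?_, le_max_of_le_right (le_max_of_le_left ?_),
    -- The distance `ε = (1 - r) / Mφ` comes from `|e| ≤ r / φ = 1 / φ - (1 - r) / φ` and `φ ≤ Mφ`.
    le_max_of_le_right (le_max_of_le_right ?_)⟩⟩, (1 - r) / Mφ, div_pos (by linarith) hMφ0,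
    fun t => ?_⟩
  · rw [funnelControl, abs_div, abs_neg, abs_of_pos (h1r.trans_le (hden t))]
    exact div_le_div₀ (by positivity) (he t) h1r (hden t)
  · rw [funnelGain, abs_of_pos (one_div_pos.2 (h1r.trans_le (hden t)))]
    exact one_div_le_one_div_of_le h1r (hden t)
  · have : ⟪x t, (c : H)⟫ = trackingError (c : H) yref x t + yref t := by simp [trackingError]
    rw [this]
    exact (abs_add_le _ _).trans (add_le_add (he t) (hY t))
  · have h1 : |trackingError (c : H) yref x t| ≤ r / φ t := by
      rw [le_div_iff₀ (hφ.pos t), mul_comm]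
      exact hxr t
    have h2 : (1 - r) / Mφ ≤ (1 - r) / φ t :=
      div_le_div_of_nonneg_left (by linarith) (hφ.pos t) ((le_abs_self _).trans (hMφ t))
    rw [sub_div 1 r (φ t)] at h2
    linarith

end Feasibility

end Funnel

end

theorem theorem2 {H : Type*} [NormedAddCommGroup H] [InnerProductSpace ℝ H] [CompleteSpace H]
    (A : H →ₗ.[ℝ] H) (hA : Funnel.GeneratesC0Semigroup A)
    (f : H → H) (hf : ∃ L : ℝ≥0, LipschitzWith L f)
    (b : A.domain) (c : A†.domain) (hbc : 0 < ⟪(b : H), (c : H)⟫)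
    (hBISBO : Funnel.IsBISBOStable A f b c) :
    -- the internal dynamics driven by `y` has a unique mild solution, so that `T` is well defined
    (∀ (η₀ : Funnel.InternalSpace (b : H)) (y : C(ℝ≥0, ℝ)),
      ∃! η : C(ℝ≥0, Funnel.InternalSpace (b : H)), Funnel.IsInternalSolution A f b c η₀ y η) ∧
    -- in the variables `y = ⟪x, c⟫`, `η = P^⊥ x`, the system `x' = A x + f x + b v` is the
    -- internal dynamics coupled with `y' = T (y) + γ v`, where `γ = ⟪b, c⟫`
    (∀ (v : ℝ≥0 → ℝ), Funnel.MemLinftyLoc v → ∀ (x₀ : H) (x : C(ℝ≥0, H)) (y : C(ℝ≥0, ℝ)),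
      Funnel.IsMildSolution A x₀ (fun s => f (x s) + v s • (b : H)) ∞ x →
      (∀ t, y t = ⟪x t, (c : H)⟫) →
      (∀ t, Funnel.projI (b : H) (x t) =
        Funnel.internalState A f b c (Funnel.projI (b : H) x₀) y t) ∧
      ∀ t : ℝ≥0, y t = ⟪x₀, (c : H)⟫ + ∫ s in (0 : ℝ)..t,
        (Funnel.outputOperator A f b c (Funnel.projI (b : H) x₀) y s.toNNReal +
          ⟪(b : H), (c : H)⟫ * v s.toNNReal)) ∧
    -- `T` maps into `L^∞_loc` and is BIBO, causal and locally Lipschitz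
    (∀ η₀ : Funnel.InternalSpace (b : H),
      Funnel.IsAdmissibleOperator (Funnel.outputOperator A f b c η₀)) ∧
    -- the funnel controller is feasible
    (∀ d yref φ : ℝ≥0 → ℝ, Funnel.MemLinfty d → Funnel.MemW1infty yref →
      Funnel.IsFunnelFunction φ → ∀ x₀ : H, φ 0 * |⟪x₀, (c : H)⟫ - yref 0| < 1 →
      ∃ x : ℝ≥0 → H,
        Funnel.IsClosedLoopSolution A f (b : H) (c : H) d yref φ x₀ ∞ x ∧
        (∀ (ω : ℝ≥0∞) (x' : ℝ≥0 → H),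
          Funnel.IsClosedLoopSolution A f (b : H) (c : H) d yref φ x₀ ω x' →
          ∀ t : ℝ≥0, (t : ℝ≥0∞) < ω → x' t = x t) ∧
        (∃ M : ℝ, ∀ t : ℝ≥0,
          |Funnel.funnelControl φ (Funnel.trackingError (c : H) yref x) t| ≤ M ∧
          |Funnel.funnelGain φ (Funnel.trackingError (c : H) yref x) t| ≤ M ∧
          |⟪x t, (c : H)⟫| ≤ M) ∧
        ∃ ε : ℝ, 0 < ε ∧
          ∀ t : ℝ≥0, |Funnel.trackingError (c : H) yref x t| ≤ 1 / φ t - ε) := by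
  have hcb : ⟪(c : H), (b : H)⟫ ≠ 0 := by rw [real_inner_comm]; exact hbc.ne'
  refine ⟨fun η₀ y => ?_, fun v hv x₀ x y hx hy => Funnel.byrnesIsidori_form hA hf hcb hv hx hy,
    Funnel.isAdmissibleOperator_outputOperator hA hf hcb hBISBO,
    fun d yref φ hd hy hφ x₀ h0 => Funnel.funnelControl_feasible hA hf hbc hBISBO hd hy hφ h0⟩
  obtain ⟨η, hη⟩ := Funnel.exists_internalSolution hA hf hcb η₀ y
  exact ⟨η, hη, fun η' hη' => Funnel.internalSolution_unique hA hf hcb hη' hη⟩
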